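/- **Notation.** Let $d$ be a dimension and let $(u,\phi)$ denote the action of a tempered distribution $u\in\mathscr S'(\mathbf R^n)$ on $\phi\in\mathscr S(\mathbf R^n)$, linear in $u$ and conjugate linear in $\phi$, extending the $L^2$ inner product. For a window $\varphi\in\mathscr S(\mathbf R^n)\setminus\{0\}$ the short-time Fourier transform of $u\in\mathscr S'(\mathbf R^n)$ is $$V_\varphi u(x,\xi)=(2\pi)^{-n/2}\,(u,M_\xi T_x\varphi),\qquad M_\xi T_x\varphi(y)=e^{i\langle y,\xi\rangle}\varphi(y-x),\qquad x,\xi\in\mathbf R^n .$$ For $s>0$ the $s$-Gabor wave front set $\mathrm{WF}_{\rm g}^s(u)\subseteq \mathbf R^{2n}\setminus\{0\}$, defined with a fixed but arbitrary nonzero Schwartz window $\varphi$, is the set of all $z_0\in\mathbf R^{2n}\setminus\{0\}$ for which there is no open set $U\subseteq\mathbf R^{2n}$ with $z_0\in U$ and $$\sup_{(x,\xi)\in U,\ \lambda>0}\lambda^N\,|V_\varphi u(\lambda x,\lambda^s\xi)|<\infty\qquad\text{for all } N\ge 0 .$$ For $K\in\mathscr S'(\mathbf R^{2d})$ put $$\mathrm{WF}_{\rm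 g,1}^s(K)=\{(x,\xi)\in\mathbf R^{2d}:(x,0,\xi,0)\in\mathrm{WF}_{\rm g}^s(K)\},\qquad \mathrm{WF}_{\rm g,2}^s(K)=\{(y,\eta)\in\mathbf R^{2d}:(0,y,0,-\eta)\in\mathrm{WF}_{\rm g}^s(K)\},$$ and let $\mathscr K:\mathscr S(\mathbf R^d)\to\mathscr S'(\mathbf R^d)$ be the continuous linear operator with kernel $K$, that is $(\mathscr K f,g)=(K,g\otimes\overline f)$ for $f,g\in\mathscr S(\mathbf R^d)$, where $(g\otimes h)(x,y)=g(x)h(y)$. **Proposition 4.2.** Let $s>0$ and $K\in\mathscr S'(\mathbf R^{2d})$. If $\mathrm{WF}_{\rm g,1}^s(K)=\mathrm{WF}_{\rm g,2}^s(K)=\emptyset$, then (i) $\mathscr K$ maps $\mathscr S(\mathbf R^d)$ into $\mathscr S(\mathbf R^d)$, and $\mathscr K:\mathscr S(\mathbf R^d)\to\mathscr S(\mathbf R^d)$ is continuous; (ii) $\mathscr K$ extends uniquely to a sequentially continuous linear operator $\mathscr K:\mathscr S'(\mathbf R^d)\to\mathscr S'(\mathbf R^d)$, where $\mathscr S'(\mathbf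 R^d)$ carries the weak-$*$ topology; (iii) if $\varphi\in\mathscr S(\mathbf R^d)$, $\|\varphi\|_{L^2}=1$, $\Phi=\varphi\otimes\varphi\in\mathscr S(\mathbf R^{2d})$, $u\in\mathscr S'(\mathbf R^d)$ and $\psi\in\mathscr S(\mathbf R^d)$, then the extension in (ii) satisfies $$(\mathscr K u,\psi)=\int_{\mathbf R^{4d}}V_\Phi K(x,y,\xi,-\eta)\,\overline{V_\varphi\psi(x,\xi)}\,V_{\overline\varphi}u(y,\eta)\,\mathrm dx\,\mathrm dy\,\mathrm d\xi\,\mathrm d\eta ,$$ and this integral converges absolutely. -/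

import Mathlib

open MeasureTheory SchwartzMap

noncomputable section

namespace GaborWF

/-- `ℝᵈ` with its Euclidean structure. -/
abbrev Rd (d : ℕ) : Type := EuclideanSpace ℝ (Fin d)

/-- `ℝ²ᵈ = ℝᵈ × ℝᵈ` with its Euclidean structure; the point `(x, y)` is `WithLp.toLp 2 (x, y)`. -/
abbrev R2d (d : ℕ) : Type := WithLp 2 (Rd d × Rd d)

section Conj

variable {V : Type*} [NormedAddCommGroup V] [NormedSpace ℝ V]

/-- The complex conjugate `x ↦ conj (φ x)` of a Schwartz function. -/
def conjS (φ : 𝓢(V, ℂ)) : 𝓢(V, ℂ) :=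
  SchwartzMap.postcompCLM (𝕜 := ℝ) (Complex.conjCLE : ℂ →L[ℝ] ℂ) φ

theorem conjS_apply (φ : 𝓢(V, ℂ)) (x : V) : conjS φ x = (starRingEnd ℂ) (φ x) := rfl

/-- The pairing `(u, φ)`, linear in the distribution `u` and conjugate linear in the test function
`φ`, which extends the `L²` inner product `∫ u(x) conj (φ x) dx`. Mathlib's tempered distributions
act linearly, so `(u, φ) = u (conj φ)`. -/
def pair (u : 𝓢'(V, ℂ)) (φ : 𝓢(V, ℂ)) : ℂ := u (conjS φ)

end Conj

section STFT

variable {V : Type*} [NormedAddCommGroup V] [InnerProductSpace ℝ V]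

theorem iteratedDeriv_expI (n : ℕ) :
    iteratedDeriv n (fun t : ℝ => Complex.exp (t * Complex.I))
      = fun t : ℝ => Complex.I ^ n * Complex.exp (t * Complex.I) := by
  induction n with
  | zero => simp
  | succ n ih =>
    rw [iteratedDeriv_succ, ih]
    funext t
    have h : HasDerivAt (fun t : ℝ => Complex.exp (t * Complex.I))
        (Complex.exp (t * Complex.I) * (1 * Complex.I)) t :=
      ((Complex.ofRealCLM.hasDerivAt (x := t)).mul_const Complex.I).cexp
    rw [(h.const_mul (Complex.I ^ n)).deriv]
    ring

theorem hasTemperateGrowth_expI :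
    (fun t : ℝ => Complex.exp (t * Complex.I)).HasTemperateGrowth := by
  refine ⟨(Complex.ofRealCLM.contDiff.mul contDiff_const).cexp, fun n => ⟨0, 1, fun t => ?_⟩⟩
  rw [norm_iteratedFDeriv_eq_norm_iteratedDeriv, iteratedDeriv_expI]
  simp [Complex.norm_exp_ofReal_mul_I]

theorem hasTemperateGrowth_character (ξ : V) :
    (fun y : V => Complex.exp ((inner ℝ y ξ : ℝ) * Complex.I)).HasTemperateGrowth :=
  hasTemperateGrowth_expI.comp (Function.hasTemperateGrowth_inner_left ξ)

/-- The time-frequency shift `Π(x, ξ) φ = M_ξ T_x φ`, that is `y ↦ exp(i⟨y, ξ⟩) φ(y - x)`. -/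
def timeFreqShift (x ξ : V) (φ : 𝓢(V, ℂ)) : 𝓢(V, ℂ) :=
  SchwartzMap.smulLeftCLM ℂ (fun y : V => Complex.exp ((inner ℝ y ξ : ℝ) * Complex.I))
    (SchwartzMap.compSubConstCLM ℂ x φ)

theorem timeFreqShift_apply (x ξ : V) (φ : 𝓢(V, ℂ)) (y : V) :
    timeFreqShift x ξ φ y = Complex.exp ((inner ℝ y ξ : ℝ) * Complex.I) * φ (y - x) := by
  simp [timeFreqShift, SchwartzMap.smulLeftCLM_apply_apply (hasTemperateGrowth_character ξ)]

/-- The short-time Fourier transform `V_φ u (x, ξ) = (2π)^{-n/2} (u, M_ξ T_x φ)`, `n = dim V`. -/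
def stft (φ : 𝓢(V, ℂ)) (u : 𝓢'(V, ℂ)) (x ξ : V) : ℂ :=
  (((2 * Real.pi) ^ (-(Module.finrank ℝ V : ℝ) / 2) : ℝ) : ℂ) * pair u (timeFreqShift x ξ φ)

/-- The `s`-Gabor wave front set of `u`, computed with the window `φ`: a subset of
`T*V ∖ 0 = (V × V) ∖ {0}`. A nonzero point `z₀` lies outside it iff there is an open `U ∋ z₀` with
`sup_{(x, ξ) ∈ U, t > 0} t ^ N |V_φ u (t x, t ^ s ξ)| < ∞` for every `N`. -/
def gaborWF (s : ℝ) (φ : 𝓢(V, ℂ)) (u : 𝓢'(V, ℂ)) : Set (V × V) :=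
  {z₀ | z₀ ≠ 0 ∧ ¬ ∃ U : Set (V × V), IsOpen U ∧ z₀ ∈ U ∧
    ∀ N : ℕ, ∃ C : ℝ, ∀ z ∈ U, ∀ t : ℝ, 0 < t →
      t ^ N * ‖stft φ u (t • z.1) (t ^ s • z.2)‖ ≤ C}

end STFT

section Tensor

variable {V W : Type*} [NormedAddCommGroup V] [InnerProductSpace ℝ V]
  [NormedAddCommGroup W] [InnerProductSpace ℝ W]

/-- `(g ⊗ f)(x, y) = g(x) f(y)`, as a function. -/
def tensorFun (g : 𝓢(V, ℂ)) (f : 𝓢(W, ℂ)) (z : WithLp 2 (V × W)) : ℂ := g z.fst * f z.snd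

theorem contDiff_tensorFun (g : 𝓢(V, ℂ)) (f : 𝓢(W, ℂ)) :
    ContDiff ℝ (⊤ : ℕ∞) (tensorFun g f) :=
  ((g.smooth ⊤).comp (WithLp.fstL 2 ℝ V W).contDiff).mul
    ((f.smooth ⊤).comp (WithLp.sndL 2 ℝ V W).contDiff)

theorem norm_iteratedFDeriv_comp_le {E F : Type*} [NormedAddCommGroup E] [NormedSpace ℝ E]
    [NormedAddCommGroup F] [NormedSpace ℝ F] (L : E →L[ℝ] F) (hL : ‖L‖ ≤ 1) (g : 𝓢(F, ℂ)) (i : ℕ)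
    (z : E) : ‖iteratedFDeriv ℝ i (g ∘ L) z‖ ≤ ‖iteratedFDeriv ℝ i g (L z)‖ := by
  rw [L.iteratedFDeriv_comp_right (g.smooth ⊤) z (mod_cast le_top)]
  refine (ContinuousMultilinearMap.norm_compContinuousLinearMap_le _ _).trans ?_
  refine mul_le_of_le_one_right (norm_nonneg _) ?_
  exact Finset.prod_le_one (fun _ _ => norm_nonneg _) (fun _ _ => hL)

theorem tensorFun_bound (k n : ℕ) (g : 𝓢(V, ℂ)) (f : 𝓢(W, ℂ)) (z : WithLp 2 (V × W)) :
    ‖z‖ ^ k * ‖iteratedFDeriv ℝ n (tensorFun g f) z‖ ≤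
      (2 ^ n * 2 ^ k * 2 ^ k) * (Finset.Iic (k, n)).sup (schwartzSeminormFamily ℂ V ℂ) g
        * (Finset.Iic (k, n)).sup (schwartzSeminormFamily ℂ W ℂ) f := by
  have hfst : ‖WithLp.fstL 2 ℝ V W‖ ≤ 1 :=
    ContinuousLinearMap.opNorm_le_bound _ zero_le_one fun z => by
      simpa using WithLp.norm_fst_le (p := 2) V z
  have hsnd : ‖WithLp.sndL 2 ℝ V W‖ ≤ 1 :=
    ContinuousLinearMap.opNorm_le_bound _ zero_le_one fun z => by
      simpa using WithLp.norm_snd_le (p := 2) V z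
  have hz : ‖z‖ ≤ (1 + ‖z.fst‖) * (1 + ‖z.snd‖) := by
    have h : ‖z‖ ≤ ‖z.fst‖ + ‖z.snd‖ := by
      rw [WithLp.prod_norm_eq_of_L2]
      refine Real.sqrt_le_iff.mpr ⟨by positivity, ?_⟩
      nlinarith [norm_nonneg z.fst, norm_nonneg z.snd]
    nlinarith [norm_nonneg z.fst, norm_nonneg z.snd, mul_nonneg (norm_nonneg z.fst) (norm_nonneg z.snd)]
  set G := (Finset.Iic (k, n)).sup (schwartzSeminormFamily ℂ V ℂ) g with hG
  set H := (Finset.Iic (k, n)).sup (schwartzSeminormFamily ℂ W ℂ) f with hH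
  have hmul := norm_iteratedFDeriv_mul_le (𝕜 := ℝ) (N := (⊤ : ℕ∞))
    ((g.smooth ⊤).comp (WithLp.fstL 2 ℝ V W).contDiff)
    ((f.smooth ⊤).comp (WithLp.sndL 2 ℝ V W).contDiff) z (n := n) (mod_cast le_top)
  have key : ∀ i ∈ Finset.range (n + 1),
      ‖z‖ ^ k * ((n.choose i : ℝ) * ‖iteratedFDeriv ℝ i (g ∘ WithLp.fstL 2 ℝ V W) z‖ *
        ‖iteratedFDeriv ℝ (n - i) (f ∘ WithLp.sndL 2 ℝ V W) z‖)
      ≤ (n.choose i : ℝ) * ((2 ^ k * G) * (2 ^ k * H)) := by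
    intro i hi
    have h1 : (1 + ‖z.fst‖) ^ k * ‖iteratedFDeriv ℝ i g z.fst‖ ≤ 2 ^ k * G :=
      SchwartzMap.one_add_le_sup_seminorm_apply (𝕜 := ℂ) (m := (k, n)) le_rfl
        (Nat.lt_succ_iff.mp (Finset.mem_range.mp hi)) g z.fst
    have h2 : (1 + ‖z.snd‖) ^ k * ‖iteratedFDeriv ℝ (n - i) f z.snd‖ ≤ 2 ^ k * H :=
      SchwartzMap.one_add_le_sup_seminorm_apply (𝕜 := ℂ) (m := (k, n)) le_rfl
        (Nat.sub_le n i) f z.snd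
    calc _ ≤ ((1 + ‖z.fst‖) * (1 + ‖z.snd‖)) ^ k *
          ((n.choose i : ℝ) * ‖iteratedFDeriv ℝ i g z.fst‖ *
            ‖iteratedFDeriv ℝ (n - i) f z.snd‖) := by
          gcongr
          · exact norm_iteratedFDeriv_comp_le _ hfst g i z
          · exact norm_iteratedFDeriv_comp_le _ hsnd f (n - i) z
      _ = (n.choose i : ℝ) * (((1 + ‖z.fst‖) ^ k * ‖iteratedFDeriv ℝ i g z.fst‖) *
            ((1 + ‖z.snd‖) ^ k * ‖iteratedFDeriv ℝ (n - i) f z.snd‖)) := by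
          rw [mul_pow]; ring
      _ ≤ _ := by gcongr
  calc ‖z‖ ^ k * ‖iteratedFDeriv ℝ n (tensorFun g f) z‖
      ≤ ‖z‖ ^ k * ∑ i ∈ Finset.range (n + 1), (n.choose i : ℝ) *
          ‖iteratedFDeriv ℝ i (g ∘ WithLp.fstL 2 ℝ V W) z‖ *
          ‖iteratedFDeriv ℝ (n - i) (f ∘ WithLp.sndL 2 ℝ V W) z‖ := by
        gcongr
        exact hmul
    _ ≤ ∑ i ∈ Finset.range (n + 1), (n.choose i : ℝ) * ((2 ^ k * G) * (2 ^ k * H)) := by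
        rw [Finset.mul_sum]
        exact Finset.sum_le_sum key
    _ = _ := by
        rw [← Finset.sum_mul]
        have : (∑ i ∈ Finset.range (n + 1), (n.choose i : ℝ)) = 2 ^ n := by
          exact_mod_cast Nat.sum_range_choose n
        rw [this]; ring

/-- `g ↦ g ⊗ f` for fixed `f`. -/
def tensorLeftCLM (f : 𝓢(W, ℂ)) : 𝓢(V, ℂ) →L[ℂ] 𝓢(WithLp 2 (V × W), ℂ) :=
  SchwartzMap.mkCLM (fun g => tensorFun g f)
    (fun _ _ _ => by simp [tensorFun, add_mul]) (fun _ _ _ => by simp [tensorFun, mul_assoc])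
    (fun g => contDiff_tensorFun g f)
    (fun m => ⟨Finset.Iic m, (2 ^ m.2 * 2 ^ m.1 * 2 ^ m.1) *
        (Finset.Iic m).sup (schwartzSeminormFamily ℂ W ℂ) f, by positivity, fun g z => by
      have h := tensorFun_bound m.1 m.2 g f z
      linarith⟩)

/-- `f ↦ g ⊗ f` for fixed `g`. -/
def tensorRightCLM (g : 𝓢(V, ℂ)) : 𝓢(W, ℂ) →L[ℂ] 𝓢(WithLp 2 (V × W), ℂ) :=
  SchwartzMap.mkCLM (fun f => tensorFun g f)
    (fun _ _ _ => by simp [tensorFun, mul_add])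
    (fun _ _ _ => by simp [tensorFun, mul_left_comm])
    (fun f => contDiff_tensorFun g f)
    (fun m => ⟨Finset.Iic m, (2 ^ m.2 * 2 ^ m.1 * 2 ^ m.1) *
        (Finset.Iic m).sup (schwartzSeminormFamily ℂ V ℂ) g, by positivity, fun f z =>
      tensorFun_bound m.1 m.2 g f z⟩)

/-- The tensor product `(g ⊗ f)(x, y) = g(x) f(y)` of Schwartz functions. -/
def tensor (g : 𝓢(V, ℂ)) (f : 𝓢(W, ℂ)) : 𝓢(WithLp 2 (V × W), ℂ) := tensorLeftCLM f g

theorem tensor_apply (g : 𝓢(V, ℂ)) (f : 𝓢(W, ℂ)) (z : WithLp 2 (V × W)) :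
    tensor g f z = g z.fst * f z.snd := rfl

theorem tensorRightCLM_eq (g : 𝓢(V, ℂ)) (f : 𝓢(W, ℂ)) : tensorRightCLM g f = tensor g f := rfl

end Tensor

section Kernel

variable {d : ℕ}

/-- The continuous operator `𝒦 : 𝓢(ℝᵈ) → 𝓢'(ℝᵈ)` with Schwartz kernel `K ∈ 𝓢'(ℝ²ᵈ)`. In terms of
linear actions `(𝒦 f)(g) = K(g ⊗ f)`; `pair_kernelOp` is the same identity for the conjugate linear
pairing. -/
def kernelOp (K : 𝓢'(R2d d, ℂ)) : 𝓢(Rd d, ℂ) →L[ℂ] 𝓢'(Rd d, ℂ) where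
  toFun f := PointwiseConvergenceCLM.precomp ℂ (tensorLeftCLM f) K
  map_add' f₁ f₂ := by
    ext g
    change K (tensorRightCLM g (f₁ + f₂)) = K (tensorRightCLM g f₁) + K (tensorRightCLM g f₂)
    rw [map_add, map_add]
  map_smul' c f := by
    ext g
    change K (tensorRightCLM g (c • f)) = c • K (tensorRightCLM g f)
    rw [map_smul, map_smul]
  cont := PointwiseConvergenceCLM.continuous_of_continuous_eval fun g => by
    change Continuous fun f => K (tensorRightCLM g f)
    exact (ContinuousLinearMap.continuous K).comp (tensorRightCLM g).continuous

/-- `(𝒦 f, g) = (K, g ⊗ conj f)`. -/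
theorem pair_kernelOp (K : 𝓢'(R2d d, ℂ)) (f g : 𝓢(Rd d, ℂ)) :
    pair (kernelOp K f) g = pair K (tensor g (conjS f)) := by
  change K (tensor (conjS g) f) = K (conjS (tensor g (conjS f)))
  congr 1
  ext z
  simp [tensor_apply, conjS_apply]

/-- `WF_{g,1}^s(K) = {(x, ξ) : (x, 0, ξ, 0) ∈ WF_g^s(K)}`, with window `Ψ`. -/
def gaborWF₁ (s : ℝ) (Ψ : 𝓢(R2d d, ℂ)) (K : 𝓢'(R2d d, ℂ)) : Set (Rd d × Rd d) :=
  {p | (WithLp.toLp 2 (p.1, 0), WithLp.toLp 2 (p.2, 0)) ∈ gaborWF s Ψ K}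

/-- `WF_{g,2}^s(K) = {(y, η) : (0, y, 0, -η) ∈ WF_g^s(K)}`, with window `Ψ`. -/
def gaborWF₂ (s : ℝ) (Ψ : 𝓢(R2d d, ℂ)) (K : 𝓢'(R2d d, ℂ)) : Set (Rd d × Rd d) :=
  {p | (WithLp.toLp 2 (0, p.1), WithLp.toLp 2 (0, -p.2)) ∈ gaborWF s Ψ K}

/-- The integrand `V_Φ K(x, y, ξ, -η) conj (V_φ ψ(x, ξ)) V_{conj φ} u(y, η)`, `Φ = φ ⊗ φ`, at the
point `p = (x, y, ξ, η)` of `ℝ⁴ᵈ`. -/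
def phaseSpaceIntegrand (K : 𝓢'(R2d d, ℂ)) (φ ψ : 𝓢(Rd d, ℂ)) (u : 𝓢'(Rd d, ℂ)) :
    Rd d × Rd d × Rd d × Rd d → ℂ := fun (x, y, ξ, η) =>
  stft (tensor φ φ) K (WithLp.toLp 2 (x, y)) (WithLp.toLp 2 (ξ, -η))
    * (starRingEnd ℂ) (stft φ (ψ : 𝓢'(Rd d, ℂ)) x ξ)
    * stft (conjS φ) u y η

end Kernel

end GaborWF

end

/-!
Fix a window `γ` with `‖γ‖ = 1`. Moyal's identity writes every distribution as a superposition of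
time-frequency shifts `Π(w) γ`, so an operator `L : 𝓢 → 𝓢'` is governed by its Gabor matrix
`(L Π(w) γ, Π(z) γ)`: if this decays rapidly in `z` with a polynomial loss in `w`, then `L` is
continuous on `𝓢`. For `L = 𝒦` the Gabor matrix is the short-time Fourier transform of `K` at the
point with components `z = (x, ξ)` and `(y, -η)`, where `w = (y, η)`. Compactness of the unit
sphere and the anisotropic dilations turn `WF_{g,1}(K) = ∅` into exactly this decay, and
`WF_{g,2}(K) = ∅` into the decay for the transpose of `𝒦`, whose own transpose is the extension of
`𝒦` to `𝓢'`. Uniqueness holds because `𝓢` is sequentially dense in `𝓢'`, and the integral formula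
is Moyal's identity applied twice.
-/

open FourierTransform

noncomputable section

namespace GaborWF

section SchwartzSeminorms

variable {𝕜 E F : Type*} [RCLike 𝕜] [NormedAddCommGroup E] [NormedSpace ℝ E]
  [NormedAddCommGroup F] [NormedSpace ℝ F] [NormedSpace 𝕜 F]

theorem one_add_norm_add_le {G : Type*} [SeminormedAddCommGroup G] (x y : G) :
    1 + ‖x + y‖ ≤ (1 + ‖x‖) * (1 + ‖y‖) := by
  nlinarith [norm_add_le x y, mul_nonneg (norm_nonneg x) (norm_nonneg y)]

theorem iteratedFDeriv_compSubConst (x : E) (f : 𝓢(E, F)) (n : ℕ) (y : E) :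
    iteratedFDeriv ℝ n (compSubConstCLM 𝕜 x f) y = iteratedFDeriv ℝ n f (y - x) :=
  iteratedFDeriv_comp_sub n x y

theorem iteratedFDeriv_sub_schwartz (f g : 𝓢(E, F)) (n : ℕ) (y : E) :
    iteratedFDeriv ℝ n (f - g : 𝓢(E, F)) y = iteratedFDeriv ℝ n f y - iteratedFDeriv ℝ n g y := by
  rw [FunLike.coe_sub, iteratedFDeriv_sub_apply (f.contDiffAt n) (g.contDiffAt n)]

variable [SMulCommClass ℝ 𝕜 F]

theorem continuous_finset_sup_schwartzSeminormFamily (s : Finset (ℕ × ℕ)) :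
    Continuous ⇑(s.sup (schwartzSeminormFamily 𝕜 E F)) :=
  (schwartz_withSeminorms 𝕜 E F).finset_sups.continuous_seminorm s

theorem exists_le_sup_Iic_schwartzSeminormFamily {q : Seminorm 𝕜 𝓢(E, F)} (hq : Continuous q) :
    ∃ (m : ℕ × ℕ) (C : NNReal), q ≤ C • (Finset.Iic m).sup (schwartzSeminormFamily 𝕜 E F) := by
  obtain ⟨s, C, -, h⟩ := Seminorm.bound_of_continuous (schwartz_withSeminorms 𝕜 E F) q hq
  have hs : s ⊆ Finset.Iic (s.sup id) := fun i hi => Finset.mem_Iic.mpr (Finset.le_sup (f := id) hi)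
  exact ⟨s.sup id, C, h.trans fun f =>
    mul_le_mul_of_nonneg_left (Finset.sup_mono (f := schwartzSeminormFamily 𝕜 E F) hs f) C.2⟩

variable (𝕜) in
theorem one_add_norm_pow_mul_norm_le (f : 𝓢(E, F)) (N : ℕ) (y : E) : (1 + ‖y‖) ^ N * ‖f y‖ ≤
    2 ^ N * (Finset.Iic (N, 0)).sup (schwartzSeminormFamily 𝕜 E F) f := by
  rw [← norm_iteratedFDeriv_zero (𝕜 := ℝ)]
  exact SchwartzMap.one_add_le_sup_seminorm_apply (𝕜 := 𝕜) (m := (N, 0)) le_rfl le_rfl f y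

variable (𝕜) in
theorem norm_pow_mul_iteratedFDeriv_sub_le (f : 𝓢(E, F)) {m : ℕ × ℕ} {k n : ℕ} (hk : k ≤ m.1)
    (hn : n ≤ m.2) (x y : E) :
    ‖y‖ ^ k * ‖iteratedFDeriv ℝ n f (y - x)‖ ≤
      (1 + ‖x‖) ^ k * (2 ^ m.1 * (Finset.Iic m).sup (schwartzSeminormFamily 𝕜 E F) f) := by
  have hy : ‖y‖ ≤ (1 + ‖x‖) * (1 + ‖y - x‖) := by
    simpa using (le_add_of_nonneg_left zero_le_one).trans (one_add_norm_add_le x (y - x))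
  calc ‖y‖ ^ k * ‖iteratedFDeriv ℝ n f (y - x)‖
      ≤ ((1 + ‖x‖) * (1 + ‖y - x‖)) ^ k * ‖iteratedFDeriv ℝ n f (y - x)‖ := by gcongr
    _ = (1 + ‖x‖) ^ k * ((1 + ‖y - x‖) ^ k * ‖iteratedFDeriv ℝ n f (y - x)‖) := by
        rw [mul_pow, mul_assoc]
    _ ≤ _ := mul_le_mul_of_nonneg_left
        (one_add_le_sup_seminorm_apply (𝕜 := 𝕜) hk hn f (y - x)) (by positivity)

theorem seminorm_compSubConst_sub_le (f : 𝓢(E, F)) (k n : ℕ) {x : E} (hx : ‖x‖ ≤ 1) :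
    SchwartzMap.seminorm 𝕜 k n (compSubConstCLM 𝕜 x f - f) ≤
      2 ^ k * (2 ^ k * (Finset.Iic (k, n + 1)).sup (schwartzSeminormFamily 𝕜 E F) f) * ‖x‖ := by
  refine SchwartzMap.seminorm_le_bound 𝕜 k n _ (by positivity) fun y => ?_
  have hdiff : Differentiable ℝ (iteratedFDeriv ℝ n f) :=
    (f.smooth ⊤).differentiable_iteratedFDeriv (mod_cast WithTop.coe_lt_top n)
  have hfderiv : ∀ t ∈ segment ℝ y (y - x),
      ‖fderiv ℝ (fun t => (‖y‖ ^ k) • iteratedFDeriv ℝ n f t) t‖ ≤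
        2 ^ k * (2 ^ k * (Finset.Iic (k, n + 1)).sup (schwartzSeminormFamily 𝕜 E F) f) := by
    intro t ht
    rw [segment_eq_image'] at ht
    obtain ⟨θ, hθ, rfl⟩ := ht
    beta_reduce
    have hθx : 1 + ‖θ • x‖ ≤ 2 := by
      rw [norm_smul, Real.norm_of_nonneg hθ.1]
      linarith [mul_le_one₀ hθ.2 (norm_nonneg x) hx]
    rw [sub_sub_cancel_left, smul_neg, ← sub_eq_add_neg,
      fderiv_fun_const_smul hdiff.differentiableAt]
    refine (ContinuousLinearMap.opNorm_smul_le _ _).trans ?_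
    rw [norm_fderiv_iteratedFDeriv, norm_pow, norm_norm]
    refine (norm_pow_mul_iteratedFDeriv_sub_le 𝕜 f (m := (k, n + 1)) le_rfl le_rfl _ y).trans ?_
    gcongr
  have hmv := Convex.norm_image_sub_le_of_norm_fderiv_le (𝕜 := ℝ)
    (fun t _ => (hdiff.differentiableAt (x := t)).const_smul (‖y‖ ^ k)) hfderiv
    (convex_segment _ _) (left_mem_segment ℝ _ _) (right_mem_segment ℝ _ _)
  rw [iteratedFDeriv_sub_schwartz, iteratedFDeriv_compSubConst]
  simpa [← smul_sub, norm_smul] using hmv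

theorem continuous_compSubConst (f : 𝓢(E, F)) :
    Continuous fun x : E => compSubConstCLM 𝕜 x f := by
  have hzero : Filter.Tendsto (fun h : E => compSubConstCLM 𝕜 h f) (nhds 0) (nhds f) := by
    rw [(schwartz_withSeminorms 𝕜 E F).tendsto_nhds]
    rintro ⟨k, n⟩ ε hε
    set C := 2 ^ k * (2 ^ k * (Finset.Iic (k, n + 1)).sup (schwartzSeminormFamily 𝕜 E F) f)
    have hC : Filter.Tendsto (fun h : E => C * ‖h‖) (nhds 0) (nhds 0) :=
      Continuous.tendsto' (by fun_prop) _ _ (by simp)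
    filter_upwards [hC.eventually (gt_mem_nhds hε), Metric.closedBall_mem_nhds (0 : E) one_pos]
      with h hlt hmem
    exact (seminorm_compSubConst_sub_le f k n (by simpa using hmem)).trans_lt hlt
  refine continuous_iff_continuousAt.mpr fun x₀ => ?_
  have hx₀ : Filter.Tendsto (fun x => compSubConstCLM 𝕜 (x - x₀) f) (nhds x₀) (nhds f) :=
    hzero.comp (Continuous.tendsto' (by fun_prop) _ _ (sub_self x₀))
  refine (((compSubConstCLM 𝕜 x₀).continuous.tendsto f).comp hx₀).congr fun x => ?_
  simp

end SchwartzSeminorms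

section PolyBounded

variable {E F Z : Type*} [NormedAddCommGroup E] [NormedSpace ℝ E]
  [NormedAddCommGroup F] [NormedSpace ℝ F]
  {𝕜 : Type*} [RCLike 𝕜] [NormedSpace 𝕜 F] [SMulCommClass ℝ 𝕜 F]

/-- A family of operators on Schwartz space is polynomially bounded with respect to a weight `w` if
every continuous seminorm of `A z f` is at most `w z ^ N` times a continuous seminorm of `f`. -/
def PolyBounded (w : Z → ℝ) (A : Z → 𝓢(E, F) →L[𝕜] 𝓢(E, F)) : Prop :=
  ∀ q : Seminorm 𝕜 𝓢(E, F), Continuous q → ∃ q' : Seminorm 𝕜 𝓢(E, F), Continuous q' ∧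
    ∃ N : ℕ, ∀ z f, q (A z f) ≤ w z ^ N * q' f

theorem PolyBounded.mono {w w' : Z → ℝ} {A : Z → 𝓢(E, F) →L[𝕜] 𝓢(E, F)} (hA : PolyBounded w A)
    (hw : ∀ z, 0 ≤ w z) (hww' : ∀ z, w z ≤ w' z) : PolyBounded w' A := fun q hq => by
  obtain ⟨q', hq', N, h⟩ := hA q hq
  refine ⟨q', hq', N, fun z f => (h z f).trans ?_⟩
  gcongr
  exacts [hw z, hww' z]

theorem PolyBounded.comp {w : Z → ℝ} {A B : Z → 𝓢(E, F) →L[𝕜] 𝓢(E, F)} (hA : PolyBounded w A)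
    (hB : PolyBounded w B) (hw : ∀ z, 0 ≤ w z) : PolyBounded w fun z => A z ∘L B z := fun q hq => by
  obtain ⟨q₁, hq₁, N₁, h₁⟩ := hA q hq
  obtain ⟨q₂, hq₂, N₂, h₂⟩ := hB q₁ hq₁
  refine ⟨q₂, hq₂, N₁ + N₂, fun z f => (h₁ z (B z f)).trans ?_⟩
  calc w z ^ N₁ * q₁ (B z f) ≤ w z ^ N₁ * (w z ^ N₂ * q₂ f) :=
        mul_le_mul_of_nonneg_left (h₂ z f) (pow_nonneg (hw z) _)
    _ = w z ^ (N₁ + N₂) * q₂ f := by rw [pow_add, mul_assoc]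

theorem PolyBounded.comp_param {Z' : Type*} {w : Z → ℝ} {A : Z → 𝓢(E, F) →L[𝕜] 𝓢(E, F)}
    (hA : PolyBounded w A) (g : Z' → Z) : PolyBounded (w ∘ g) fun z => A (g z) := fun q hq => by
  obtain ⟨q', hq', N, h⟩ := hA q hq
  exact ⟨q', hq', N, fun z => h (g z)⟩

theorem PolyBounded.continuous_apply [TopologicalSpace Z] {w : Z → ℝ}
    {A : Z → 𝓢(E, F) →L[𝕜] 𝓢(E, F)} (hA : PolyBounded w A) (hw : Continuous w)
    (hcont : ∀ f, Continuous fun z => A z f) {g : Z → 𝓢(E, F)} (hg : Continuous g) :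
    Continuous fun z => A z (g z) := by
  refine continuous_iff_continuousAt.mpr fun z₀ => ?_
  have hdiff : Filter.Tendsto (fun z => A z (g z - g z₀)) (nhds z₀) (nhds 0) := by
    rw [(schwartz_withSeminorms 𝕜 E F).tendsto_nhds]
    intro i ε hε
    obtain ⟨q', hq', N, h⟩ := hA _ ((schwartz_withSeminorms 𝕜 E F).continuous_seminorm i)
    have hbound : Filter.Tendsto (fun z => w z ^ N * q' (g z - g z₀)) (nhds z₀) (nhds 0) :=
      Continuous.tendsto' (by fun_prop) _ _ (by simp)
    filter_upwards [hbound.eventually (gt_mem_nhds hε)] with z hz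
    simpa using (h z _).trans_lt hz
  simpa [ContinuousAt] using ((hcont (g z₀)).tendsto z₀).add hdiff

theorem polyBounded_compSubConst :
    PolyBounded (fun x : E => 1 + ‖x‖) fun x => compSubConstCLM (F := F) 𝕜 x := fun q hq => by
  obtain ⟨m, C, h⟩ := exists_le_sup_Iic_schwartzSeminormFamily hq
  refine ⟨C • (2 ^ m.1 : NNReal) • (Finset.Iic m).sup (schwartzSeminormFamily 𝕜 E F),
    ((continuous_finset_sup_schwartzSeminormFamily _).const_smul _).const_smul C, m.1,
    fun x f => (h _).trans ?_⟩
  have hsup : (Finset.Iic m).sup (schwartzSeminormFamily 𝕜 E F) (compSubConstCLM 𝕜 x f) ≤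
      (1 + ‖x‖) ^ m.1 * (2 ^ m.1 * (Finset.Iic m).sup (schwartzSeminormFamily 𝕜 E F) f) := by
    refine Seminorm.finset_sup_apply_le (by positivity) fun i hi => ?_
    have hi : i ≤ m := Finset.mem_Iic.mp hi
    refine SchwartzMap.seminorm_le_bound 𝕜 _ _ _ (by positivity) fun y => ?_
    rw [iteratedFDeriv_compSubConst]
    refine (norm_pow_mul_iteratedFDeriv_sub_le 𝕜 f hi.1 hi.2 x y).trans ?_
    gcongr
    exacts [le_add_of_nonneg_right (norm_nonneg x), hi.1]
  refine (mul_le_mul_of_nonneg_left hsup C.2).trans_eq ?_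
  simp only [smul_apply, NNReal.smul_def, smul_eq_mul]
  push_cast
  rw [mul_left_comm]
  rfl

end PolyBounded

section TimeFreqShift

variable {V : Type*} [NormedAddCommGroup V] [InnerProductSpace ℝ V]

/-- The modulation `M_ξ f (y) = exp(i⟨y, ξ⟩) f(y)`. -/
def modulation (ξ : V) : 𝓢(V, ℂ) →L[ℂ] 𝓢(V, ℂ) :=
  SchwartzMap.smulLeftCLM ℂ (fun y : V => Complex.exp ((inner ℝ y ξ : ℝ) * Complex.I))

theorem modulation_apply (ξ : V) (f : 𝓢(V, ℂ)) (y : V) :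
    modulation ξ f y = Complex.exp ((inner ℝ y ξ : ℝ) * Complex.I) * f y := by
  simp [modulation, SchwartzMap.smulLeftCLM_apply_apply (hasTemperateGrowth_character ξ)]

theorem timeFreqShift_eq (x ξ : V) (f : 𝓢(V, ℂ)) :
    timeFreqShift x ξ f = modulation ξ (compSubConstCLM ℂ x f) := rfl

variable [FiniteDimensional ℝ V] [MeasurableSpace V] [BorelSpace V]

theorem fourierInv_compSubConst (x : V) (f : 𝓢(V, ℂ)) (ω : V) :
    𝓕⁻ (compSubConstCLM ℂ x f) ω
      = Complex.exp ((2 * Real.pi * inner ℝ x ω : ℝ) * Complex.I) * 𝓕⁻ f ω := by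
  rw [fourierInv_coe, fourierInv_coe, Real.fourierInv_eq', Real.fourierInv_eq',
    ← integral_const_mul, ← integral_add_right_eq_self _ x]
  congr 1
  ext v
  simp only [compSubConstCLM_apply, add_sub_cancel_right, smul_eq_mul, ← mul_assoc,
    ← Complex.exp_add, inner_add_left]
  congr 2
  push_cast
  ring

theorem modulation_eq_fourierInv (ξ : V) (f : 𝓢(V, ℂ)) :
    modulation ξ f = 𝓕⁻ (compSubConstCLM ℂ ((2 * Real.pi)⁻¹ • ξ) (𝓕 f)) := by
  ext y
  rw [fourierInv_compSubConst, modulation_apply, FourierPair.fourierInv_fourier_eq,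
    inner_smul_left, real_inner_comm, conj_trivial, mul_inv_cancel_left₀ Real.two_pi_pos.ne']

theorem polyBounded_modulation : PolyBounded (fun ξ : V => 1 + ‖ξ‖) modulation := fun q hq => by
  obtain ⟨q', hq', N, h⟩ := polyBounded_compSubConst
    (q.comp (fourierInvCLM ℂ 𝓢(V, ℂ) : 𝓢(V, ℂ) →L[ℂ] 𝓢(V, ℂ)).toLinearMap)
    (hq.comp (fourierInvCLM ℂ 𝓢(V, ℂ)).continuous)
  refine ⟨q'.comp (fourierCLM ℂ 𝓢(V, ℂ) : 𝓢(V, ℂ) →L[ℂ] 𝓢(V, ℂ)).toLinearMap,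
    hq'.comp (fourierCLM ℂ 𝓢(V, ℂ)).continuous, N, fun ξ f => ?_⟩
  rw [modulation_eq_fourierInv]
  have hξ : ‖(2 * Real.pi)⁻¹ • ξ‖ ≤ ‖ξ‖ := by
    rw [norm_smul, Real.norm_of_nonneg (by positivity)]
    exact mul_le_of_le_one_left (norm_nonneg _)
      (inv_le_one_of_one_le₀ (by linarith [Real.pi_gt_three]))
  refine (h ((2 * Real.pi)⁻¹ • ξ) (𝓕 f)).trans ?_
  change _ ≤ _ * q' (𝓕 f)
  gcongr
  exact add_le_add_right hξ 1

theorem continuous_modulation (f : 𝓢(V, ℂ)) : Continuous fun ξ : V => modulation ξ f := by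
  simp only [modulation_eq_fourierInv]
  exact (fourierInvCLM ℂ 𝓢(V, ℂ)).continuous.comp
    ((continuous_compSubConst (𝓕 f)).comp (by fun_prop))

theorem continuous_timeFreqShift (f : 𝓢(V, ℂ)) :
    Continuous fun z : V × V => timeFreqShift z.1 z.2 f :=
  (polyBounded_modulation.comp_param Prod.snd).continuous_apply (by fun_prop)
    (fun f => (continuous_modulation f).comp continuous_snd)
    ((continuous_compSubConst f).comp continuous_fst)

/-- The polynomial weight `(1 + |x|) (1 + |ξ|)` on phase space. -/
def weight {V W : Type*} [Norm V] [Norm W] (z : V × W) : ℝ := (1 + ‖z.1‖) * (1 + ‖z.2‖)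

theorem polyBounded_timeFreqShift : PolyBounded weight fun z : V × V =>
    modulation z.2 ∘L compSubConstCLM ℂ z.1 := by
  refine PolyBounded.comp ((polyBounded_modulation.comp_param Prod.snd).mono ?_ ?_)
    ((polyBounded_compSubConst.comp_param Prod.fst).mono ?_ ?_) ?_ <;>
  intro z <;> simp only [Function.comp_apply, weight] <;>
  nlinarith [norm_nonneg z.1, norm_nonneg z.2, mul_nonneg (norm_nonneg z.1) (norm_nonneg z.2)]

end TimeFreqShift

section SchwartzIntegral

variable {E F Z : Type*} [NormedAddCommGroup E] [NormedSpace ℝ E]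
  [NormedAddCommGroup F] [NormedSpace ℝ F] [TopologicalSpace Z] [MeasurableSpace Z]
  {μ : Measure Z} {Θ : Z → 𝓢(E, F)}

/-- A continuous family of Schwartz functions all of whose seminorms are integrable; this is what
makes the integral of the family a Schwartz function. -/
structure SchwartzIntegrable (μ : Measure Z) (Θ : Z → 𝓢(E, F)) : Prop where
  continuous : Continuous Θ
  integrable_seminorm (k n : ℕ) : Integrable (fun z => SchwartzMap.seminorm ℝ k n (Θ z)) μ

omit [MeasurableSpace Z] in
theorem continuous_iteratedFDeriv_apply (hΘ : Continuous Θ) (n : ℕ) (y : E) :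
    Continuous fun z => iteratedFDeriv ℝ n (Θ z) y := by
  refine continuous_iff_continuousAt.mpr fun z₀ => Metric.tendsto_nhds.mpr fun ε hε => ?_
  filter_upwards [(schwartz_withSeminorms ℝ E F).tendsto_nhds Θ (Θ z₀) |>.mp
    (hΘ.tendsto z₀) (0, n) ε hε] with z hz
  rw [dist_eq_norm, ← iteratedFDeriv_sub_schwartz]
  exact (SchwartzMap.norm_iteratedFDeriv_le_seminorm ℝ _ n y).trans_lt hz

namespace SchwartzIntegrable

variable [SecondCountableTopology Z] [OpensMeasurableSpace Z]

theorem integrable_iteratedFDeriv (hΘ : SchwartzIntegrable μ Θ) (n : ℕ) (y : E) :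
    Integrable (fun z => iteratedFDeriv ℝ n (Θ z) y) μ :=
  (hΘ.integrable_seminorm 0 n).mono'
    (continuous_iteratedFDeriv_apply hΘ.continuous n y).aestronglyMeasurable
    (.of_forall fun z => SchwartzMap.norm_iteratedFDeriv_le_seminorm ℝ (Θ z) n y)

theorem hasFDerivAt_integral_iteratedFDeriv [CompleteSpace F] (hΘ : SchwartzIntegrable μ Θ) (n : ℕ)
    (y : E) : HasFDerivAt (fun y => ∫ z, iteratedFDeriv ℝ n (Θ z) y ∂μ)
      (∫ z, iteratedFDeriv ℝ (n + 1) (Θ z) y ∂μ).curryLeft y := by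
  let curry : (E [×(n + 1)]→L[ℝ] F) →L[ℝ] E →L[ℝ] E [×n]→L[ℝ] F :=
    (continuousMultilinearCurryLeftEquiv ℝ
      (fun _ : Fin (n + 1) => E) F).toContinuousLinearEquiv.toContinuousLinearMap
  have hfderiv : ∀ y z, fderiv ℝ (iteratedFDeriv ℝ n (Θ z)) y =
      curry (iteratedFDeriv ℝ (n + 1) (Θ z) y) := fun y z => by
    rw [fderiv_iteratedFDeriv]
    rfl
  have hderiv := hasFDerivAt_integral_of_dominated_of_fderiv_le (𝕜 := ℝ) (μ := μ) (x₀ := y)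
    (F := fun y z => iteratedFDeriv ℝ n (Θ z) y)
    (F' := fun y z => fderiv ℝ (iteratedFDeriv ℝ n (Θ z)) y) Filter.univ_mem
    (.of_forall fun y =>
      (continuous_iteratedFDeriv_apply hΘ.continuous n y).aestronglyMeasurable)
    (hΘ.integrable_iteratedFDeriv n y)
    (by
      simp only [hfderiv]
      exact curry.continuous.comp_aestronglyMeasurable
        (hΘ.integrable_iteratedFDeriv (n + 1) y).aestronglyMeasurable)
    (.of_forall fun z y _ => by
      rw [norm_fderiv_iteratedFDeriv]
      exact SchwartzMap.norm_iteratedFDeriv_le_seminorm ℝ (Θ z) (n + 1) y)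
    (hΘ.integrable_seminorm 0 (n + 1))
    (.of_forall fun z y _ => (((Θ z).smooth ⊤).differentiable_iteratedFDeriv
      (mod_cast WithTop.coe_lt_top n) y).hasFDerivAt)
  have hcurry : ∫ z, fderiv ℝ (iteratedFDeriv ℝ n (Θ z)) y ∂μ =
      (∫ z, iteratedFDeriv ℝ (n + 1) (Θ z) y ∂μ).curryLeft := by
    simp only [hfderiv]
    exact ContinuousLinearMap.integral_comp_comm (𝕜 := ℝ) (E := E [×(n + 1)]→L[ℝ] F)
      (Fₗ := E →L[ℝ] E [×n]→L[ℝ] F) curry (hΘ.integrable_iteratedFDeriv (n + 1) y)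
  exact hcurry ▸ hderiv

theorem hasFTaylorSeriesUpTo_integral [CompleteSpace F] (hΘ : SchwartzIntegrable μ Θ) :
    HasFTaylorSeriesUpTo (⊤ : ℕ∞) (fun y => ∫ z, Θ z y ∂μ)
      (fun y n => ∫ z, iteratedFDeriv ℝ n (Θ z) y ∂μ) where
  zero_eq y := by
    change continuousMultilinearCurryFin0 ℝ E F (∫ z, iteratedFDeriv ℝ 0 (Θ z) y ∂μ) = _
    refine ((continuousMultilinearCurryFin0 ℝ E
      F).toContinuousLinearEquiv.toContinuousLinearMap.integral_comp_comm
      (hΘ.integrable_iteratedFDeriv 0 y)).symm.trans ?_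
    simp
  fderiv n _ := hΘ.hasFDerivAt_integral_iteratedFDeriv n
  cont n _ := continuous_iff_continuousAt.mpr fun y =>
    (hΘ.hasFDerivAt_integral_iteratedFDeriv n y).continuousAt

omit [SecondCountableTopology Z] [OpensMeasurableSpace Z] in
theorem norm_pow_mul_norm_integral_le (hΘ : SchwartzIntegrable μ Θ) (k n : ℕ) (y : E) :
    ‖y‖ ^ k * ‖∫ z, iteratedFDeriv ℝ n (Θ z) y ∂μ‖ ≤
      ∫ z, SchwartzMap.seminorm ℝ k n (Θ z) ∂μ := by
  rw [← norm_norm y, ← norm_pow, ← norm_smul, ← integral_smul]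
  refine norm_integral_le_of_norm_le (hΘ.integrable_seminorm k n) (.of_forall fun z => ?_)
  rw [norm_smul, norm_pow, norm_norm]
  exact SchwartzMap.le_seminorm ℝ k n (Θ z) y

end SchwartzIntegrable

variable [SecondCountableTopology Z] [OpensMeasurableSpace Z] [CompleteSpace F]

/-- The Schwartz function `y ↦ ∫ Θ z y ∂μ(z)`. -/
def schwartzIntegral (hΘ : SchwartzIntegrable μ Θ) : 𝓢(E, F) where
  toFun y := ∫ z, Θ z y ∂μ
  smooth' := hΘ.hasFTaylorSeriesUpTo_integral.contDiff
  decay' k n := ⟨∫ z, SchwartzMap.seminorm ℝ k n (Θ z) ∂μ, fun y => by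
    rw [← hΘ.hasFTaylorSeriesUpTo_integral.eq_iteratedFDeriv (mod_cast le_top)]
    exact hΘ.norm_pow_mul_norm_integral_le k n y⟩

theorem schwartzIntegral_apply (hΘ : SchwartzIntegrable μ Θ) (y : E) :
    schwartzIntegral hΘ y = ∫ z, Θ z y ∂μ := rfl

theorem iteratedFDeriv_schwartzIntegral (hΘ : SchwartzIntegrable μ Θ) (n : ℕ) (y : E) :
    iteratedFDeriv ℝ n (schwartzIntegral hΘ) y = ∫ z, iteratedFDeriv ℝ n (Θ z) y ∂μ :=
  (hΘ.hasFTaylorSeriesUpTo_integral.eq_iteratedFDeriv (mod_cast le_top) y).symm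

theorem seminorm_schwartzIntegral_le (hΘ : SchwartzIntegrable μ Θ) (k n : ℕ) :
    SchwartzMap.seminorm ℝ k n (schwartzIntegral hΘ) ≤
      ∫ z, SchwartzMap.seminorm ℝ k n (Θ z) ∂μ := by
  refine SchwartzMap.seminorm_le_bound ℝ k n _ (integral_nonneg fun z => apply_nonneg _ _)
    fun y => ?_
  rw [iteratedFDeriv_schwartzIntegral]
  exact hΘ.norm_pow_mul_norm_integral_le k n y

end SchwartzIntegral

section Jet

variable {𝕜 E F : Type*} [RCLike 𝕜] [NormedAddCommGroup E] [NormedSpace ℝ E]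
  [NormedAddCommGroup F] [NormedSpace ℝ F] [NormedSpace 𝕜 F] [SMulCommClass ℝ 𝕜 F]

open scoped BoundedContinuousFunction

/-- Bounded continuous maps into a normed space. The metric on the codomain is the one given by the
norm; the instance found for `E [×n]→L[ℝ] F` alone does not unify with it. -/
abbrev BoundedMap (X G : Type*) [TopologicalSpace X] [NormedAddCommGroup G] : Type _ := X →ᵇ G

variable (𝕜) in
/-- The weighted derivative `y ↦ |y| ^ k • Dⁿf(y)` as a bounded continuous function; its sup norm is
the Schwartz seminorm of index `(k, n)`. -/
def weightedDeriv (k n : ℕ) : 𝓢(E, F) →ₗ[𝕜] BoundedMap E (E [×n]→L[ℝ] F) where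
  toFun f := .ofNormedAddCommGroup (fun y => ‖y‖ ^ k • iteratedFDeriv ℝ n f y)
    ((continuous_norm.pow k).smul ((f.smooth ⊤).continuous_iteratedFDeriv (mod_cast le_top)))
    (SchwartzMap.seminorm 𝕜 k n f) fun y => by
      rw [norm_smul, norm_pow, norm_norm]
      exact SchwartzMap.le_seminorm 𝕜 k n f y
  map_add' f g := by
    ext1 y
    change ‖y‖ ^ k • iteratedFDeriv ℝ n (⇑f + ⇑g) y =
      ‖y‖ ^ k • iteratedFDeriv ℝ n f y + ‖y‖ ^ k • iteratedFDeriv ℝ n g y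
    rw [iteratedFDeriv_add_apply (f.contDiffAt n) (g.contDiffAt n), smul_add]
  map_smul' c f := by
    ext1 y
    change ‖y‖ ^ k • iteratedFDeriv ℝ n (c • ⇑f) y = c • ‖y‖ ^ k • iteratedFDeriv ℝ n f y
    rw [iteratedFDeriv_const_smul_apply (f.contDiffAt n), smul_comm]

theorem norm_weightedDeriv (k n : ℕ) (f : 𝓢(E, F)) :
    ‖weightedDeriv 𝕜 k n f‖ = SchwartzMap.seminorm 𝕜 k n f := by
  refine le_antisymm ((BoundedContinuousFunction.norm_le (apply_nonneg _ _)).mpr fun y => ?_)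
    (SchwartzMap.seminorm_le_bound 𝕜 k n f (norm_nonneg (weightedDeriv 𝕜 k n f)) fun y => ?_)
  · refine Eq.trans_le ?_ (SchwartzMap.le_seminorm 𝕜 k n f y)
    exact (norm_smul _ _).trans (by rw [norm_pow, norm_norm])
  · refine Eq.trans_le ?_ ((weightedDeriv 𝕜 k n f).norm_coe_le_norm y)
    exact .symm ((norm_smul _ _).trans (by rw [norm_pow, norm_norm]))

/-- The Banach space in which the weighted derivatives indexed by `s` take their values. -/
def JetSpace (s : Finset (ℕ × ℕ)) (E F : Type*) [NormedAddCommGroup E] [NormedSpace ℝ E]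
    [NormedAddCommGroup F] [NormedSpace ℝ F] : Type _ :=
  ∀ i : s, BoundedMap E (E [×i.1.2]→L[ℝ] F)

instance (s : Finset (ℕ × ℕ)) : NormedAddCommGroup (JetSpace s E F) :=
  inferInstanceAs (NormedAddCommGroup (∀ i : s, BoundedMap E (E [×i.1.2]→L[ℝ] F)))

instance (s : Finset (ℕ × ℕ)) : NormedSpace 𝕜 (JetSpace s E F) :=
  inferInstanceAs (NormedSpace 𝕜 (∀ i : s, BoundedMap E (E [×i.1.2]→L[ℝ] F)))

instance [CompleteSpace F] (s : Finset (ℕ × ℕ)) : CompleteSpace (JetSpace s E F) :=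
  inferInstanceAs (CompleteSpace (∀ i : s, BoundedMap E (E [×i.1.2]→L[ℝ] F)))

variable (𝕜) in
/-- The weighted derivatives indexed by `s`. Every continuous functional on `𝓢(E, F)` factors
through one of these maps, which reduces its integration to Banach spaces. -/
def jet (s : Finset (ℕ × ℕ)) : 𝓢(E, F) →ₗ[𝕜] JetSpace s E F :=
  LinearMap.pi fun i : s => weightedDeriv 𝕜 i.1.1 i.1.2

theorem norm_jet (s : Finset (ℕ × ℕ)) (f : 𝓢(E, F)) :
    ‖jet 𝕜 s f‖ = s.sup (schwartzSeminormFamily 𝕜 E F) f := by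
  refine le_antisymm ((pi_norm_le_iff_of_nonneg (apply_nonneg _ _)).mpr fun i => ?_)
    (Seminorm.finset_sup_apply_le (norm_nonneg _) fun i hi => ?_)
  · exact (norm_weightedDeriv (𝕜 := 𝕜) _ _ f).trans_le
      (Finset.le_sup (f := schwartzSeminormFamily 𝕜 E F) i.2 f)
  · exact (norm_weightedDeriv (𝕜 := 𝕜) _ _ f).symm.trans_le
      (norm_le_pi_norm (fun i : s => weightedDeriv 𝕜 i.1.1 i.1.2 f) ⟨i, hi⟩)

theorem continuous_jet (s : Finset (ℕ × ℕ)) : Continuous (jet 𝕜 (E := E) (F := F) s) := by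
  refine (schwartz_withSeminorms 𝕜 E F).continuous_normedSpace_rng _ (jet 𝕜 s) ⟨s, 1, fun f => ?_⟩
  rw [one_smul]
  exact (norm_jet s f).le

theorem exists_eq_comp_of_norm_le {M G : Type*} [AddCommGroup M] [Module 𝕜 M]
    [NormedAddCommGroup G] [NormedSpace 𝕜 G] (J : M →ₗ[𝕜] G) (u : M →ₗ[𝕜] 𝕜) {C : ℝ}
    (hu : ∀ f, ‖u f‖ ≤ C * ‖J f‖) : ∃ v : G →L[𝕜] 𝕜, ∀ f, u f = v (J f) := by
  obtain ⟨σ, hσ⟩ := J.rangeRestrict.exists_rightInverse_of_surjective J.range_rangeRestrict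
  have hJσ : ∀ x, J (σ x) = x := fun x => congr_arg Subtype.val (LinearMap.congr_fun hσ x)
  obtain ⟨v, hv, -⟩ := exists_extension_norm_eq (LinearMap.range J)
    ((u ∘ₗ σ).mkContinuous C fun x => (hu (σ x)).trans_eq (by rw [hJσ]; rfl))
  refine ⟨v, fun f => ?_⟩
  have hker : u (f - σ (J.rangeRestrict f)) = 0 := norm_le_zero_iff.mp <|
    (hu _).trans_eq (by rw [map_sub, hJσ]; simp)
  rw [map_sub, sub_eq_zero] at hker
  exact hker.trans (hv (J.rangeRestrict f)).symm

theorem exists_eq_comp_jet (u : 𝓢(E, F) →L[𝕜] 𝕜) :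
    ∃ (s : Finset (ℕ × ℕ)) (v : JetSpace s E F →L[𝕜] 𝕜), ∀ f, u f = v (jet 𝕜 s f) := by
  obtain ⟨s, C, -, h⟩ := Seminorm.bound_of_continuous (schwartz_withSeminorms 𝕜 E F)
    ((normSeminorm 𝕜 𝕜).comp u.toLinearMap) (continuous_norm.comp u.continuous)
  exact ⟨s, exists_eq_comp_of_norm_le (jet 𝕜 s) u.toLinearMap (C := C) fun f => by
    rw [norm_jet]
    exact h f⟩

variable {Z : Type*} [TopologicalSpace Z] [MeasurableSpace Z] [SecondCountableTopology Z]
  [OpensMeasurableSpace Z] {μ : Measure Z} {Θ : Z → 𝓢(E, F)}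

theorem SchwartzIntegrable.integrable_jet (𝕜 : Type*) [RCLike 𝕜] [NormedSpace 𝕜 F]
    [SMulCommClass ℝ 𝕜 F] (hΘ : SchwartzIntegrable μ Θ) (s : Finset (ℕ × ℕ)) :
    Integrable (fun z => jet 𝕜 s (Θ z)) μ := by
  refine Integrable.mono' (g := fun z => ∑ i ∈ s, schwartzSeminormFamily 𝕜 E F i (Θ z))
    (integrable_finsetSum _ fun i _ => hΘ.integrable_seminorm i.1 i.2)
    ((continuous_jet s).comp hΘ.continuous).aestronglyMeasurable (.of_forall fun z => ?_)
  rw [norm_jet]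
  simpa using Seminorm.finset_sup_le_sum (schwartzSeminormFamily 𝕜 E F) s (Θ z)

theorem integrable_continuousLinearMap_comp (u : 𝓢(E, F) →L[𝕜] 𝕜)
    (hΘ : SchwartzIntegrable μ Θ) : Integrable (fun z => u (Θ z)) μ := by
  obtain ⟨s, v, hv⟩ := exists_eq_comp_jet u
  simpa only [hv] using v.integrable_comp (hΘ.integrable_jet 𝕜 s)

variable [CompleteSpace F]

theorem jet_schwartzIntegral (hΘ : SchwartzIntegrable μ Θ) (s : Finset (ℕ × ℕ)) :
    jet 𝕜 s (schwartzIntegral hΘ) = ∫ z, jet 𝕜 s (Θ z) ∂μ := by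
  refine funext fun i => BoundedContinuousFunction.ext fun y => ?_
  let eval : JetSpace s E F →L[ℝ] E [×i.1.2]→L[ℝ] F :=
    BoundedContinuousFunction.evalCLM ℝ y ∘L
      ContinuousLinearMap.proj (φ := fun i : s => BoundedMap E (E [×i.1.2]→L[ℝ] F)) i
  refine Eq.trans ?_ (eval.integral_comp_comm (hΘ.integrable_jet 𝕜 s))
  change ‖y‖ ^ i.1.1 • iteratedFDeriv ℝ i.1.2 (schwartzIntegral hΘ) y =
    ∫ z, ‖y‖ ^ i.1.1 • iteratedFDeriv ℝ i.1.2 (Θ z) y ∂μ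
  rw [iteratedFDeriv_schwartzIntegral, integral_smul]

theorem continuousLinearMap_schwartzIntegral (u : 𝓢(E, F) →L[𝕜] 𝕜)
    (hΘ : SchwartzIntegrable μ Θ) : u (schwartzIntegral hΘ) = ∫ z, u (Θ z) ∂μ := by
  obtain ⟨s, v, hv⟩ := exists_eq_comp_jet u
  simp only [hv, jet_schwartzIntegral, v.integral_comp_comm (hΘ.integrable_jet 𝕜 s)]

end Jet

section Weight

variable {V W : Type*} [NormedAddCommGroup V] [NormedAddCommGroup W]

theorem one_le_one_add_norm (x : V) : 1 ≤ 1 + ‖x‖ := le_add_of_nonneg_right (norm_nonneg x)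

theorem one_le_weight (z : V × W) : 1 ≤ weight z :=
  one_le_mul_of_one_le_of_one_le (one_le_one_add_norm _) (one_le_one_add_norm _)

theorem weight_pos (z : V × W) : 0 < weight z := zero_lt_one.trans_le (one_le_weight z)

theorem continuous_weight : Continuous (weight : V × W → ℝ) := by
  unfold weight
  fun_prop

theorem weight_add_le (z w : V × W) : weight (z + w) ≤ weight z * weight w :=
  (mul_le_mul (one_add_norm_add_le z.1 w.1) (one_add_norm_add_le z.2 w.2) (by positivity)
    (by positivity)).trans_eq (mul_mul_mul_comm _ _ _ _)

theorem weight_neg (z : V × W) : weight (-z) = weight z := by simp [weight]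

theorem weight_neg_snd (z : V × W) : weight (z.1, -z.2) = weight z := by simp [weight]

theorem weight_pow_le (z : V × W) (N : ℕ) :
    weight z ^ N ≤ (1 + ‖z.1‖) ^ (2 * N) + (1 + ‖z.2‖) ^ (2 * N) := by
  rw [weight, mul_pow, mul_comm 2 N, pow_mul, pow_mul]
  nlinarith [sq_nonneg ((1 + ‖z.1‖) ^ N - (1 + ‖z.2‖) ^ N),
    sq_nonneg ((1 + ‖z.1‖) ^ N), sq_nonneg ((1 + ‖z.2‖) ^ N)]

section Integrable

variable [NormedSpace ℝ V] [FiniteDimensional ℝ V] [MeasurableSpace V] [BorelSpace V]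
  [NormedSpace ℝ W] [FiniteDimensional ℝ W] [MeasurableSpace W] [BorelSpace W]

theorem exists_integrable_one_add_norm_pow (μ : Measure V) [μ.IsAddHaarMeasure] :
    ∃ D : ℕ, ∀ n ≥ D, Integrable (fun x : V => ((1 + ‖x‖) ^ n)⁻¹) μ := by
  refine ⟨Module.finrank ℝ V + 1, fun n hn => ?_⟩
  have h := integrable_one_add_norm (E := V) (μ := μ) (r := n) (mod_cast Nat.lt_of_succ_le hn)
  refine h.congr (.of_forall fun x => ?_)
  simp only [Real.rpow_neg (zero_le_one.trans (one_le_one_add_norm x)), Real.rpow_natCast]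

theorem exists_integrable_weight_pow (μ : Measure V) [μ.IsAddHaarMeasure]
    (ν : Measure W) [ν.IsAddHaarMeasure] :
    ∃ D : ℕ, ∀ n ≥ D, Integrable (fun z : V × W => (weight z ^ n)⁻¹) (μ.prod ν) := by
  obtain ⟨D₁, h₁⟩ := exists_integrable_one_add_norm_pow μ
  obtain ⟨D₂, h₂⟩ := exists_integrable_one_add_norm_pow ν
  refine ⟨max D₁ D₂, fun n hn => ?_⟩
  refine ((h₁ n (le_of_max_le_left hn)).mul_prod (h₂ n (le_of_max_le_right hn))).congr
    (.of_forall fun z => ?_)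
  simp [weight, mul_pow, mul_comm]

end Integrable

/-- `H` decays faster than every power of the weight `w`. -/
def RapidlyDecreasing {Z G : Type*} [Norm G] (w : Z → ℝ) (H : Z → G) : Prop :=
  ∀ N : ℕ, ∃ C : ℝ, ∀ z, w z ^ N * ‖H z‖ ≤ C

namespace RapidlyDecreasing

theorem of_norm_le {Z G G' : Type*} [Norm G] [Norm G'] {w : Z → ℝ} {H : Z → G} {H' : Z → G'}
    (hH : RapidlyDecreasing w H) (hw : ∀ z, 0 ≤ w z) {C : ℝ} (hC : 0 ≤ C) {N : ℕ}
    (h : ∀ z, ‖H' z‖ ≤ C * w z ^ N * ‖H z‖) : RapidlyDecreasing w H' := fun M => by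
  obtain ⟨B, hB⟩ := hH (M + N)
  refine ⟨C * B, fun z => ?_⟩
  have hwz := hw z
  calc w z ^ M * ‖H' z‖ ≤ w z ^ M * (C * w z ^ N * ‖H z‖) := by gcongr; exact h z
    _ = C * (w z ^ (M + N) * ‖H z‖) := by ring
    _ ≤ C * B := by gcongr; exact hB z

theorem integrable {G : Type*} [NormedAddCommGroup G] [NormedSpace ℝ V] [FiniteDimensional ℝ V]
    [MeasurableSpace V] [BorelSpace V] [NormedSpace ℝ W] [FiniteDimensional ℝ W]
    [MeasurableSpace W] [BorelSpace W] {μ : Measure V} [μ.IsAddHaarMeasure] {ν : Measure W}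
    [ν.IsAddHaarMeasure] {H : V × W → G} (hH : RapidlyDecreasing weight H)
    (hcont : Continuous H) : Integrable H (μ.prod ν) := by
  obtain ⟨D, hD⟩ := exists_integrable_weight_pow μ ν
  obtain ⟨C, hC⟩ := hH D
  refine ((hD D le_rfl).const_mul C).mono' hcont.aestronglyMeasurable (.of_forall fun z => ?_)
  rw [← div_eq_mul_inv, le_div_iff₀ (pow_pos (weight_pos z) D), mul_comm]
  exact hC z

end RapidlyDecreasing

end Weight

section STFT

variable {V : Type*} [NormedAddCommGroup V] [InnerProductSpace ℝ V]

/-- The normalising constant `(2π)^{-n/2}` of the short-time Fourier transform. -/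
def stftConst (V : Type*) [NormedAddCommGroup V] [InnerProductSpace ℝ V] : ℝ :=
  (2 * Real.pi) ^ (-(Module.finrank ℝ V : ℝ) / 2)

theorem stftConst_pos : 0 < stftConst V := Real.rpow_pos_of_pos Real.two_pi_pos _

theorem stftConst_sq_mul : stftConst V ^ 2 * (2 * Real.pi) ^ Module.finrank ℝ V = 1 := by
  rw [stftConst, ← Real.rpow_natCast, ← Real.rpow_mul Real.two_pi_pos.le, ← Real.rpow_natCast,
    ← Real.rpow_add Real.two_pi_pos, Nat.cast_ofNat, div_mul_cancel₀ _ two_ne_zero,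
    neg_add_cancel, Real.rpow_zero]

theorem stft_eq (φ : 𝓢(V, ℂ)) (u : 𝓢'(V, ℂ)) (x ξ : V) :
    stft φ u x ξ = (stftConst V : ℂ) * pair u (timeFreqShift x ξ φ) := rfl

theorem norm_stft (φ : 𝓢(V, ℂ)) (u : 𝓢'(V, ℂ)) (x ξ : V) :
    ‖stft φ u x ξ‖ = stftConst V * ‖pair u (timeFreqShift x ξ φ)‖ := by
  rw [stft_eq, norm_mul, Complex.norm_real, Real.norm_of_nonneg stftConst_pos.le]

theorem conjS_conjS (φ : 𝓢(V, ℂ)) : conjS (conjS φ) = φ :=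
  SchwartzMap.ext fun x => Complex.conj_conj (φ x)

theorem conjS_timeFreqShift (x ξ : V) (φ : 𝓢(V, ℂ)) :
    conjS (timeFreqShift x ξ φ) = timeFreqShift x (-ξ) (conjS φ) := by
  ext y
  rw [conjS_apply, timeFreqShift_apply, timeFreqShift_apply, conjS_apply, map_mul,
    ← Complex.exp_conj, map_mul, Complex.conj_ofReal, Complex.conj_I, inner_neg_right,
    Complex.ofReal_neg, neg_mul_comm]

theorem stft_eq_apply (φ : 𝓢(V, ℂ)) (u : 𝓢'(V, ℂ)) (x ξ : V) :
    stft φ u x ξ = (stftConst V : ℂ) * u (timeFreqShift x (-ξ) (conjS φ)) := by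
  rw [stft_eq, pair, conjS_timeFreqShift]

theorem norm_timeFreqShift_apply (x ξ : V) (φ : 𝓢(V, ℂ)) (y : V) :
    ‖timeFreqShift x ξ φ y‖ = ‖φ (y - x)‖ := by
  rw [timeFreqShift_apply, norm_mul, Complex.norm_exp_ofReal_mul_I, one_mul]

variable [FiniteDimensional ℝ V] [MeasurableSpace V] [BorelSpace V]

theorem continuous_stft (φ : 𝓢(V, ℂ)) (u : 𝓢'(V, ℂ)) :
    Continuous fun z : V × V => stft φ u z.1 z.2 := by
  simp only [stft_eq_apply]
  refine continuous_const.mul ((ContinuousLinearMap.continuous u).comp ?_)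
  exact (continuous_timeFreqShift (conjS φ)).comp (continuous_fst.prodMk continuous_snd.neg)

theorem exists_norm_stft_le (φ : 𝓢(V, ℂ)) (u : 𝓢'(V, ℂ)) :
    ∃ (C : ℝ) (N : ℕ), 0 ≤ C ∧ ∀ z : V × V, ‖stft φ u z.1 z.2‖ ≤ C * weight z ^ N := by
  obtain ⟨q, -, N, h⟩ := polyBounded_timeFreqShift
    ((normSeminorm ℂ ℂ).comp (u : 𝓢(V, ℂ) →ₗ[ℂ] ℂ))
    (continuous_norm.comp (ContinuousLinearMap.continuous u))
  refine ⟨stftConst V * q (conjS φ), N, mul_nonneg stftConst_pos.le (apply_nonneg _ _),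
    fun z => ?_⟩
  have hz := h (z.1, -z.2) (conjS φ)
  rw [weight_neg_snd] at hz
  rw [norm_stft, pair, conjS_timeFreqShift, mul_assoc, mul_comm (q _)]
  exact mul_le_mul_of_nonneg_left hz stftConst_pos.le

theorem pair_coe (f g : 𝓢(V, ℂ)) :
    pair (f : 𝓢'(V, ℂ)) g = ∫ y, (starRingEnd ℂ) (g y) * f y :=
  SchwartzMap.coe_apply f (conjS g)

theorem exists_seminorm_integral_norm_mul_le (φ : 𝓢(V, ℂ)) (N : ℕ) :
    ∃ q : Seminorm ℂ 𝓢(V, ℂ), Continuous q ∧ ∀ (f : 𝓢(V, ℂ)) (x : V),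
      (1 + ‖x‖) ^ N * ∫ y, ‖φ (y - x)‖ * ‖f y‖ ≤ q f := by
  obtain ⟨D, hD⟩ := exists_integrable_one_add_norm_pow (volume : Measure V)
  let P (M : ℕ) : Seminorm ℂ 𝓢(V, ℂ) := (Finset.Iic (M, 0)).sup (schwartzSeminormFamily ℂ V ℂ)
  let c : NNReal := ⟨2 ^ N * P N φ * 2 ^ (N + D) * ∫ y : V, ((1 + ‖y‖) ^ D)⁻¹,
    mul_nonneg (by positivity) (integral_nonneg fun y => by positivity)⟩
  refine ⟨c • P (N + D), (continuous_finset_sup_schwartzSeminormFamily _).const_smul c,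
    fun f x => ?_⟩
  have hpointwise : ∀ y, (1 + ‖x‖) ^ N * (‖φ (y - x)‖ * ‖f y‖) ≤
      2 ^ N * P N φ * (2 ^ (N + D) * P (N + D) f) * ((1 + ‖y‖) ^ D)⁻¹ := fun y => by
    have hx : 1 + ‖x‖ ≤ (1 + ‖y - x‖) * (1 + ‖y‖) := by
      simpa [norm_sub_rev x y] using one_add_norm_add_le (x - y) y
    rw [← div_eq_mul_inv, le_div_iff₀ (by positivity)]
    calc (1 + ‖x‖) ^ N * (‖φ (y - x)‖ * ‖f y‖) * (1 + ‖y‖) ^ D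
        ≤ ((1 + ‖y - x‖) * (1 + ‖y‖)) ^ N * (‖φ (y - x)‖ * ‖f y‖) * (1 + ‖y‖) ^ D := by gcongr
      _ = ((1 + ‖y - x‖) ^ N * ‖φ (y - x)‖) * ((1 + ‖y‖) ^ (N + D) * ‖f y‖) := by
          rw [mul_pow, pow_add]
          ring
      _ ≤ _ := mul_le_mul (one_add_norm_pow_mul_norm_le ℂ φ N _)
          (one_add_norm_pow_mul_norm_le ℂ f (N + D) y) (by positivity) (by positivity)
  calc (1 + ‖x‖) ^ N * ∫ y, ‖φ (y - x)‖ * ‖f y‖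
      = ∫ y, (1 + ‖x‖) ^ N * (‖φ (y - x)‖ * ‖f y‖) := (integral_const_mul _ _).symm
    _ ≤ ∫ y : V, 2 ^ N * P N φ * (2 ^ (N + D) * P (N + D) f) * ((1 + ‖y‖) ^ D)⁻¹ :=
        integral_mono_of_nonneg (.of_forall fun y => by positivity)
          ((hD D le_rfl).const_mul _) (.of_forall hpointwise)
    _ = 2 ^ N * P N φ * 2 ^ (N + D) * (∫ y : V, ((1 + ‖y‖) ^ D)⁻¹) * P (N + D) f := by
        rw [integral_const_mul]
        ring
    _ = (c • P (N + D)) f := rfl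

theorem exists_seminorm_pair_timeFreqShift_fst_le (φ : 𝓢(V, ℂ)) (N : ℕ) :
    ∃ q : Seminorm ℂ 𝓢(V, ℂ), Continuous q ∧ ∀ (f : 𝓢(V, ℂ)) (x ξ : V),
      (1 + ‖x‖) ^ N * ‖pair (f : 𝓢'(V, ℂ)) (timeFreqShift x ξ φ)‖ ≤ q f := by
  obtain ⟨q, hq, h⟩ := exists_seminorm_integral_norm_mul_le φ N
  refine ⟨q, hq, fun f x ξ => le_trans ?_ (h f x)⟩
  gcongr
  rw [pair_coe]
  refine (norm_integral_le_integral_norm _).trans_eq ?_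
  simp only [norm_mul, RCLike.norm_conj, norm_timeFreqShift_apply]

theorem norm_fourier_compSubConst (x : V) (f : 𝓢(V, ℂ)) (ω : V) :
    ‖𝓕 (compSubConstCLM ℂ x f) ω‖ = ‖𝓕 f ω‖ := by
  rw [← neg_neg ω, fourier_coe, fourier_coe, ← Real.fourierInv_eq_fourier_neg,
    ← Real.fourierInv_eq_fourier_neg, ← fourierInv_coe, ← fourierInv_coe, fourierInv_compSubConst,
    norm_mul, Complex.norm_exp_ofReal_mul_I, one_mul]

theorem pair_timeFreqShift_eq_integral_fourier (φ f : 𝓢(V, ℂ)) (x ξ : V) :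
    pair (f : 𝓢'(V, ℂ)) (timeFreqShift x ξ φ) = ∫ ω,
      𝓕 (compSubConstCLM ℂ x (conjS φ)) (ω - (2 * Real.pi)⁻¹ • -ξ) * 𝓕⁻ f ω := by
  rw [pair, conjS_timeFreqShift, timeFreqShift_eq, modulation_eq_fourierInv]
  exact integral_fourierInv_mul_eq _ _

theorem exists_seminorm_pair_timeFreqShift_snd_le (φ : 𝓢(V, ℂ)) (N : ℕ) :
    ∃ q : Seminorm ℂ 𝓢(V, ℂ), Continuous q ∧ ∀ (f : 𝓢(V, ℂ)) (x ξ : V),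
      (1 + ‖ξ‖) ^ N * ‖pair (f : 𝓢'(V, ℂ)) (timeFreqShift x ξ φ)‖ ≤ q f := by
  obtain ⟨q, hq, h⟩ := exists_seminorm_integral_norm_mul_le (𝓕 (conjS φ)) N
  let Finv := (fourierInvCLM ℂ 𝓢(V, ℂ) : 𝓢(V, ℂ) →L[ℂ] 𝓢(V, ℂ))
  let c : NNReal := ⟨(2 * Real.pi) ^ N, pow_nonneg Real.two_pi_pos.le N⟩
  refine ⟨c • q.comp Finv.toLinearMap, (hq.comp Finv.continuous).const_smul c, fun f x ξ => ?_⟩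
  have hξ : 1 + ‖ξ‖ ≤ 2 * Real.pi * (1 + ‖(2 * Real.pi)⁻¹ • -ξ‖) := by
    rw [norm_smul, norm_neg, Real.norm_of_nonneg (inv_nonneg.mpr Real.two_pi_pos.le), mul_add,
      mul_inv_cancel_left₀ Real.two_pi_pos.ne']
    linarith [Real.pi_gt_three]
  have hpair : ‖pair (f : 𝓢'(V, ℂ)) (timeFreqShift x ξ φ)‖ ≤
      ∫ ω, ‖𝓕 (conjS φ) (ω - (2 * Real.pi)⁻¹ • -ξ)‖ * ‖𝓕⁻ f ω‖ := by
    rw [pair_timeFreqShift_eq_integral_fourier]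
    refine (norm_integral_le_integral_norm _).trans_eq ?_
    simp only [norm_mul, norm_fourier_compSubConst]
  calc (1 + ‖ξ‖) ^ N * ‖pair (f : 𝓢'(V, ℂ)) (timeFreqShift x ξ φ)‖
      ≤ (2 * Real.pi * (1 + ‖(2 * Real.pi)⁻¹ • -ξ‖)) ^ N *
          ∫ ω, ‖𝓕 (conjS φ) (ω - (2 * Real.pi)⁻¹ • -ξ)‖ * ‖𝓕⁻ f ω‖ := by gcongr
    _ ≤ (2 * Real.pi) ^ N * q (𝓕⁻ f) := by
        rw [mul_pow, mul_assoc]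
        gcongr
        exact h _ _

theorem exists_seminorm_stft_coe_le (φ : 𝓢(V, ℂ)) (N : ℕ) :
    ∃ q : Seminorm ℂ 𝓢(V, ℂ), Continuous q ∧ ∀ (f : 𝓢(V, ℂ)) (z : V × V),
      weight z ^ N * ‖stft φ (f : 𝓢'(V, ℂ)) z.1 z.2‖ ≤ q f := by
  obtain ⟨q₁, hq₁, h₁⟩ := exists_seminorm_pair_timeFreqShift_fst_le φ (2 * N)
  obtain ⟨q₂, hq₂, h₂⟩ := exists_seminorm_pair_timeFreqShift_snd_le φ (2 * N)
  let c : NNReal := ⟨stftConst V, stftConst_pos.le⟩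
  refine ⟨c • (q₁ + q₂), (hq₁.add hq₂).const_smul c, fun f z => ?_⟩
  rw [norm_stft, mul_left_comm]
  refine mul_le_mul_of_nonneg_left ?_ stftConst_pos.le
  refine (mul_le_mul_of_nonneg_right (weight_pow_le z N) (norm_nonneg _)).trans ?_
  rw [add_mul]
  exact add_le_add (h₁ f z.1 z.2) (h₂ f z.1 z.2)

theorem rapidlyDecreasing_stft_coe (φ f : 𝓢(V, ℂ)) :
    RapidlyDecreasing weight fun z : V × V => stft φ (f : 𝓢'(V, ℂ)) z.1 z.2 := fun N => by
  obtain ⟨q, -, h⟩ := exists_seminorm_stft_coe_le φ N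
  exact ⟨q f, h f⟩

end STFT

section Inversion

variable {V : Type*} [NormedAddCommGroup V] [InnerProductSpace ℝ V]
  [FiniteDimensional ℝ V] [MeasurableSpace V] [BorelSpace V]

theorem RapidlyDecreasing.schwartzIntegrable_smul {H : V × V → ℂ}
    (hH : RapidlyDecreasing weight H) (hcont : Continuous H) (φ : 𝓢(V, ℂ)) :
    SchwartzIntegrable volume fun z => H z • timeFreqShift z.1 z.2 φ where
  continuous := hcont.smul (continuous_timeFreqShift φ)
  integrable_seminorm k n := by
    have hq := (schwartz_withSeminorms ℂ V ℂ).continuous_seminorm (k, n)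
    obtain ⟨q, -, N, h⟩ := polyBounded_timeFreqShift _ hq
    refine RapidlyDecreasing.integrable (hH.of_norm_le (fun z => (weight_pos z).le)
      (apply_nonneg q φ) (N := N) fun z => ?_)
      (hq.comp (hcont.smul (continuous_timeFreqShift φ)))
    rw [Real.norm_of_nonneg (apply_nonneg _ _)]
    calc SchwartzMap.seminorm ℂ k n (H z • timeFreqShift z.1 z.2 φ)
        = ‖H z‖ * SchwartzMap.seminorm ℂ k n (timeFreqShift z.1 z.2 φ) := map_smul_eq_mul _ _ _
      _ ≤ ‖H z‖ * (weight z ^ N * q φ) := by gcongr; exact h z φ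
      _ = q φ * weight z ^ N * ‖H z‖ := by ring

theorem schwartzIntegrable_stft_smul (φ f : 𝓢(V, ℂ)) : SchwartzIntegrable volume
    fun z : V × V => stft φ (f : 𝓢'(V, ℂ)) z.1 z.2 • timeFreqShift z.1 z.2 φ :=
  (rapidlyDecreasing_stft_coe φ f).schwartzIntegrable_smul (continuous_stft φ _) φ

theorem stft_coe_eq_fourier (φ f : 𝓢(V, ℂ)) (x ξ : V) :
    stft φ (f : 𝓢'(V, ℂ)) x ξ = stftConst V *
      𝓕 (SchwartzMap.pairing (ContinuousLinearMap.mul ℂ ℂ) f (conjS (compSubConstCLM ℂ x φ)))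
        ((2 * Real.pi)⁻¹ • ξ) := by
  rw [stft_eq, pair_coe, fourier_coe, Real.fourier_eq']
  congr 2
  ext y
  have hphase : (-2 * Real.pi * ((2 * Real.pi)⁻¹ * inner ℝ y ξ) : ℝ) = -inner ℝ y ξ := by
    field_simp
  rw [timeFreqShift_apply, map_mul, ← Complex.exp_conj, map_mul, Complex.conj_ofReal,
    Complex.conj_I, inner_smul_right, SchwartzMap.pairing_apply_apply, smul_eq_mul,
    ContinuousLinearMap.mul_apply', conjS_apply, compSubConstCLM_apply, hphase,
    Complex.ofReal_neg, neg_mul_comm, mul_assoc, mul_comm (f y)]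

theorem stft_mul_timeFreqShift_eq_fourier (φ f : 𝓢(V, ℂ)) (x ξ y : V) :
    stft φ (f : 𝓢'(V, ℂ)) x ξ * timeFreqShift x ξ φ y = stftConst V * φ (y - x) *
      (Complex.exp ((2 * Real.pi * inner ℝ ((2 * Real.pi)⁻¹ • ξ) y : ℝ) * Complex.I) •
        𝓕 (SchwartzMap.pairing (ContinuousLinearMap.mul ℂ ℂ) f
          (conjS (compSubConstCLM ℂ x φ))) ((2 * Real.pi)⁻¹ • ξ)) := by
  have hphase : 2 * Real.pi * inner ℝ ((2 * Real.pi)⁻¹ • ξ) y = inner ℝ y ξ := by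
    rw [real_inner_smul_left, real_inner_comm, mul_inv_cancel_left₀ Real.two_pi_pos.ne']
  rw [hphase, stft_coe_eq_fourier, timeFreqShift_apply, smul_eq_mul]
  ring

theorem integral_stft_mul_timeFreqShift_snd (φ f : 𝓢(V, ℂ)) (x y : V) :
    stftConst V * ∫ ξ, stft φ (f : 𝓢'(V, ℂ)) x ξ * timeFreqShift x ξ φ y
      = f y * ((‖φ (y - x)‖ ^ 2 : ℝ) : ℂ) := by
  set h : 𝓢(V, ℂ) :=
    SchwartzMap.pairing (ContinuousLinearMap.mul ℂ ℂ) f (conjS (compSubConstCLM ℂ x φ)) with hh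
  have hinv : 𝓕⁻ (𝓕 h) y = h y := by rw [FourierPair.fourierInv_fourier_eq]
  rw [fourierInv_coe, Real.fourierInv_eq'] at hinv
  have hsub := Measure.integral_comp_inv_smul (volume : Measure V) (fun ω : V =>
    stftConst V * φ (y - x) *
      (Complex.exp ((2 * Real.pi * inner ℝ ω y : ℝ) * Complex.I) • 𝓕 h ω)) (2 * Real.pi)
  have hconst := congrArg Complex.ofReal (stftConst_sq_mul (V := V))
  have hnorm : ((‖φ (y - x)‖ ^ 2 : ℝ) : ℂ) = φ (y - x) * (starRingEnd ℂ) (φ (y - x)) := by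
    rw [Complex.mul_conj, Complex.normSq_eq_norm_sq]
  simp only [stft_mul_timeFreqShift_eq_fourier]
  rw [hsub, integral_const_mul, hinv, hh, SchwartzMap.pairing_apply_apply,
    ContinuousLinearMap.mul_apply', conjS_apply, compSubConstCLM_apply,
    abs_of_pos (by positivity), hnorm, Complex.real_smul]
  push_cast at hconst ⊢
  linear_combination (f y * φ (y - x) * (starRingEnd ℂ) (φ (y - x))) * hconst

theorem stft_inversion_apply (φ f : 𝓢(V, ℂ)) (y : V) :
    stftConst V * ∫ z : V × V, stft φ (f : 𝓢'(V, ℂ)) z.1 z.2 * timeFreqShift z.1 z.2 φ y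
      = ((∫ x, ‖φ x‖ ^ 2 : ℝ) : ℂ) * f y := by
  have hint : Integrable fun z : V × V =>
      stft φ (f : 𝓢'(V, ℂ)) z.1 z.2 * timeFreqShift z.1 z.2 φ y :=
    integrable_continuousLinearMap_comp (TemperedDistribution.delta y)
      (schwartzIntegrable_stft_smul φ f)
  rw [Measure.volume_eq_prod, integral_prod _ hint, ← integral_const_mul]
  simp only [integral_stft_mul_timeFreqShift_snd]
  rw [integral_const_mul, integral_sub_left_eq_self (fun x => ((‖φ x‖ ^ 2 : ℝ) : ℂ)),
    integral_complex_ofReal, mul_comm]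

theorem stft_inversion (φ f : 𝓢(V, ℂ)) :
    (stftConst V : ℂ) • schwartzIntegral (schwartzIntegrable_stft_smul φ f)
      = ((∫ x, ‖φ x‖ ^ 2 : ℝ) : ℂ) • f := by
  ext y
  rw [smul_apply, smul_apply, schwartzIntegral_apply]
  exact stft_inversion_apply φ f y

theorem integral_norm_sq_mul_eq_integral_stft (φ f : 𝓢(V, ℂ)) (u : 𝓢(V, ℂ) →L[ℂ] ℂ) :
    ((∫ x, ‖φ x‖ ^ 2 : ℝ) : ℂ) * u f = stftConst V *
      ∫ z : V × V, stft φ (f : 𝓢'(V, ℂ)) z.1 z.2 * u (timeFreqShift z.1 z.2 φ) := by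
  have h := congrArg u (stft_inversion φ f)
  simp only [map_smul, continuousLinearMap_schwartzIntegral, smul_eq_mul] at h
  exact h.symm

theorem integral_neg_snd {E : Type*} [NormedAddCommGroup E] [NormedSpace ℝ E] (F : V × V → E) :
    ∫ z : V × V, F (z.1, -z.2) = ∫ z, F z := by
  have h : MeasurePreserving (Prod.map id Neg.neg : V × V → V × V) volume volume :=
    (MeasurePreserving.id volume).prod (Measure.measurePreserving_neg volume)
  exact h.integral_comp ((MeasurableEquiv.refl V).prodCongr
    (MeasurableEquiv.neg V)).measurableEmbedding F

theorem stft_conjS_conjS (φ f : 𝓢(V, ℂ)) (x ξ : V) :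
    stft (conjS φ) (conjS f : 𝓢'(V, ℂ)) x ξ
      = (starRingEnd ℂ) (stft φ (f : 𝓢'(V, ℂ)) x (-ξ)) := by
  rw [stft_eq, stft_eq, pair_coe, pair_coe, map_mul, Complex.conj_ofReal, ← integral_conj]
  congr 2
  ext y
  rw [map_mul, ← conjS_apply (timeFreqShift x ξ (conjS φ)), conjS_timeFreqShift, conjS_conjS,
    Complex.conj_conj, conjS_apply]

theorem moyal (Ψ g : 𝓢(V, ℂ)) (u : 𝓢'(V, ℂ)) :
    ((∫ x, ‖Ψ x‖ ^ 2 : ℝ) : ℂ) * pair u g =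
      ∫ w : V × V, stft Ψ u w.1 w.2 * (starRingEnd ℂ) (stft Ψ (g : 𝓢'(V, ℂ)) w.1 w.2) := by
  have h := integral_norm_sq_mul_eq_integral_stft (conjS Ψ) (conjS g) u
  simp only [conjS_apply, RCLike.norm_conj] at h
  refine h.trans ?_
  rw [← integral_neg_snd, ← integral_const_mul]
  congr 1 with z
  rw [stft_conjS_conjS, stft_eq_apply Ψ u, neg_neg]
  exact (congrArg _ (mul_comm _ _)).trans (mul_assoc _ _ _).symm

theorem integrable_stft_mul_conj_stft (Ψ g : 𝓢(V, ℂ)) (u : 𝓢'(V, ℂ)) :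
    Integrable fun w : V × V =>
      stft Ψ u w.1 w.2 * (starRingEnd ℂ) (stft Ψ (g : 𝓢'(V, ℂ)) w.1 w.2) := by
  obtain ⟨C, N, hC, h⟩ := exists_norm_stft_le Ψ u
  refine RapidlyDecreasing.integrable ((rapidlyDecreasing_stft_coe Ψ g).of_norm_le
    (fun z => (weight_pos z).le) hC (N := N) fun z => ?_)
    ((continuous_stft Ψ u).mul (Complex.continuous_conj.comp (continuous_stft Ψ _)))
  rw [norm_mul, RCLike.norm_conj]
  exact mul_le_mul_of_nonneg_right (h z) (norm_nonneg _)

theorem integral_norm_sq_pos {Ψ : 𝓢(V, ℂ)} (hΨ : Ψ ≠ 0) : 0 < ∫ x, ‖Ψ x‖ ^ 2 := by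
  obtain ⟨x₀, hx₀⟩ := DFunLike.ne_iff.mp hΨ
  exact integral_pos_of_integrable_nonneg_nonzero (x := x₀) (by fun_prop)
    ((Ψ.memLp 2 volume).integrable_norm_pow two_ne_zero) (fun x => by positivity)
    (pow_ne_zero 2 (norm_ne_zero_iff.mpr hx₀))

end Inversion

/-- An even submultiplicative weight on phase space, dominated by `weight`. Such weights are the
ones against which decay of the short-time Fourier transform does not depend on the window. -/
structure ModerateWeight {V : Type*} [NormedAddCommGroup V] (a : V × V → ℝ) : Prop where
  nonneg (z : V × V) : 0 ≤ a z
  add_le (z w : V × V) : a (z + w) ≤ a z * a w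
  neg (z : V × V) : a (-z) = a z
  le_weight (z : V × V) : a z ≤ weight z

namespace ModerateWeight

variable {V : Type*} [NormedAddCommGroup V] {a b : V × V → ℝ}

theorem le_mul_sub (ha : ModerateWeight a) (z w : V × V) :
    a w ≤ a z * a (w - z) := by
  simpa only [add_sub_cancel] using ha.add_le z (w - z)

theorem le_mul_sub_rev (ha : ModerateWeight a) (z w : V × V) : a z ≤ a w * a (w - z) := by
  simpa only [← ha.neg (w - z), neg_sub] using ha.le_mul_sub w z

theorem pow_mul_mul_le (ha : ModerateWeight a) (hb : ModerateWeight b) {p : V × V → ℝ}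
    (hp : ∀ w, 0 ≤ p w) {N M : ℕ} {C : ℝ} (hC : 0 ≤ C)
    (h : ∀ w, a w ^ N * p w ≤ C * b w ^ M) (z w : V × V) {r : ℝ} (hr : 0 ≤ r) :
    a z ^ N * (p w * r) ≤ C * b z ^ M * (weight (w - z) ^ (N + M) * r) := by
  have hweight := weight_pos (w - z)
  have haz := ha.nonneg z
  have haw := ha.nonneg w
  have hbw := hb.nonneg w
  have hbz := hb.nonneg z
  have hpw := hp w
  have hasub : a z ≤ a w * weight (w - z) :=
    (ha.le_mul_sub_rev z w).trans (mul_le_mul_of_nonneg_left (ha.le_weight _) haw)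
  have hbsub : b w ≤ b z * weight (w - z) :=
    (hb.le_mul_sub z w).trans (mul_le_mul_of_nonneg_left (hb.le_weight _) hbz)
  calc a z ^ N * (p w * r) ≤ (a w * weight (w - z)) ^ N * (p w * r) := by gcongr
    _ = (a w ^ N * p w) * (weight (w - z) ^ N * r) := by rw [mul_pow]; ring
    _ ≤ (C * b w ^ M) * (weight (w - z) ^ N * r) := by gcongr ?_ * _; exact h w
    _ ≤ (C * (b z * weight (w - z)) ^ M) * (weight (w - z) ^ N * r) := by gcongr
    _ = C * b z ^ M * (weight (w - z) ^ (N + M) * r) := by rw [mul_pow, pow_add]; ring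

end ModerateWeight

section ChangeOfWindow

variable {V : Type*} [NormedAddCommGroup V] [InnerProductSpace ℝ V]
  [FiniteDimensional ℝ V] [MeasurableSpace V] [BorelSpace V]

theorem pair_timeFreqShift_timeFreqShift (Ψ Φ : 𝓢(V, ℂ)) (z w : V × V) :
    pair (timeFreqShift z.1 z.2 Φ : 𝓢'(V, ℂ)) (timeFreqShift w.1 w.2 Ψ) =
      Complex.exp ((inner ℝ z.1 (z.2 - w.2) : ℝ) * Complex.I) *
        pair (Φ : 𝓢'(V, ℂ)) (timeFreqShift (w.1 - z.1) (w.2 - z.2) Ψ) := by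
  rw [pair_coe, pair_coe, ← integral_add_right_eq_self _ z.1, ← integral_const_mul]
  congr 1 with y
  have hphase : Complex.exp ((inner ℝ (y + z.1) w.2 : ℝ) * -Complex.I) *
      Complex.exp ((inner ℝ (y + z.1) z.2 : ℝ) * Complex.I)
      = Complex.exp ((inner ℝ z.1 (z.2 - w.2) : ℝ) * Complex.I) *
        Complex.exp ((inner ℝ y (w.2 - z.2) : ℝ) * -Complex.I) := by
    rw [← Complex.exp_add, ← Complex.exp_add]
    congr 1
    simp only [inner_add_left, inner_sub_right]
    push_cast
    ring
  simp only [timeFreqShift_apply, map_mul, ← Complex.exp_conj, Complex.conj_ofReal,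
    Complex.conj_I, add_sub_cancel_right, add_sub_assoc]
  rw [show y + (z.1 - w.1) = y - (w.1 - z.1) by abel]
  linear_combination ((starRingEnd ℂ) (Ψ (y - (w.1 - z.1))) * Φ y) * hphase

theorem norm_stft_timeFreqShift (Ψ Φ : 𝓢(V, ℂ)) (z w : V × V) :
    ‖stft Ψ (timeFreqShift z.1 z.2 Φ : 𝓢'(V, ℂ)) w.1 w.2‖
      = ‖stft Ψ (Φ : 𝓢'(V, ℂ)) (w - z).1 (w - z).2‖ := by
  rw [norm_stft, norm_stft, pair_timeFreqShift_timeFreqShift, norm_mul,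
    Complex.norm_exp_ofReal_mul_I, one_mul, Prod.fst_sub, Prod.snd_sub]

theorem integrable_norm_stft_mul_norm_stft_sub (Ψ Φ : 𝓢(V, ℂ)) (u : 𝓢'(V, ℂ)) (z : V × V) :
    Integrable fun w : V × V =>
      ‖stft Ψ u w.1 w.2‖ * ‖stft Ψ (Φ : 𝓢'(V, ℂ)) (w - z).1 (w - z).2‖ := by
  simpa only [norm_mul, RCLike.norm_conj, norm_stft_timeFreqShift] using
    (integrable_stft_mul_conj_stft Ψ (timeFreqShift z.1 z.2 Φ) u).norm

theorem norm_stft_le_integral {Ψ : 𝓢(V, ℂ)} (hΨ : Ψ ≠ 0) (Φ : 𝓢(V, ℂ)) (u : 𝓢'(V, ℂ))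
    (z : V × V) :
    ‖stft Φ u z.1 z.2‖ ≤ stftConst V / (∫ x, ‖Ψ x‖ ^ 2) * ∫ w : V × V,
      ‖stft Ψ u w.1 w.2‖ * ‖stft Ψ (Φ : 𝓢'(V, ℂ)) (w - z).1 (w - z).2‖ := by
  have hI := integral_norm_sq_pos hΨ
  have h := congrArg norm (moyal Ψ (timeFreqShift z.1 z.2 Φ) u)
  rw [norm_mul, Complex.norm_real, Real.norm_of_nonneg hI.le] at h
  rw [norm_stft, div_mul_eq_mul_div, mul_div_assoc]
  refine mul_le_mul_of_nonneg_left ?_ stftConst_pos.le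
  rw [le_div_iff₀ hI, mul_comm, h]
  refine (norm_integral_le_integral_norm _).trans_eq ?_
  simp only [norm_mul, RCLike.norm_conj, norm_stft_timeFreqShift]

theorem integrable_weight_pow_mul_norm_stft (Ψ Φ : 𝓢(V, ℂ)) (N : ℕ) :
    Integrable fun w : V × V => weight w ^ N * ‖stft Ψ (Φ : 𝓢'(V, ℂ)) w.1 w.2‖ := by
  refine RapidlyDecreasing.integrable ((rapidlyDecreasing_stft_coe Ψ Φ).of_norm_le
    (fun z => (weight_pos z).le) zero_le_one (N := N) fun z => ?_)
    ((continuous_weight.pow N).mul (continuous_stft Ψ _).norm)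
  rw [norm_mul, norm_norm, norm_pow, Real.norm_of_nonneg (weight_pos z).le, one_mul]

theorem ModerateWeight.exists_pow_mul_norm_stft_le {a b : V × V → ℝ} (ha : ModerateWeight a)
    (hb : ModerateWeight b) {Ψ : 𝓢(V, ℂ)} (hΨ : Ψ ≠ 0) (Φ : 𝓢(V, ℂ)) (u : 𝓢'(V, ℂ)) {N M : ℕ}
    {C : ℝ} (hC : 0 ≤ C) (h : ∀ z : V × V, a z ^ N * ‖stft Ψ u z.1 z.2‖ ≤ C * b z ^ M) :
    ∃ C' : ℝ, 0 ≤ C' ∧ ∀ z : V × V, a z ^ N * ‖stft Φ u z.1 z.2‖ ≤ C' * b z ^ M := by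
  have hinv : (volume : Measure (V × V)).IsAddHaarMeasure :=
    inferInstanceAs ((volume : Measure V).prod volume).IsAddHaarMeasure
  have hint := integrable_weight_pow_mul_norm_stft Ψ Φ (N + M)
  set c := stftConst V / ∫ x, ‖Ψ x‖ ^ 2
  have hc : 0 ≤ c := div_nonneg stftConst_pos.le (integral_norm_sq_pos hΨ).le
  set J := ∫ w : V × V, weight w ^ (N + M) * ‖stft Ψ (Φ : 𝓢'(V, ℂ)) w.1 w.2‖
  have hJ : 0 ≤ J := integral_nonneg fun w =>
    mul_nonneg (pow_nonneg (weight_pos w).le _) (norm_nonneg _)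
  have hconv : ∀ z, a z ^ N * ∫ w : V × V, ‖stft Ψ u w.1 w.2‖ *
      ‖stft Ψ (Φ : 𝓢'(V, ℂ)) (w - z).1 (w - z).2‖ ≤ C * b z ^ M * J := fun z => by
    have hJz : ∫ w : V × V, weight (w - z) ^ (N + M) *
        ‖stft Ψ (Φ : 𝓢'(V, ℂ)) (w - z).1 (w - z).2‖ = J :=
      integral_sub_right_eq_self (fun w : V × V =>
        weight w ^ (N + M) * ‖stft Ψ (Φ : 𝓢'(V, ℂ)) w.1 w.2‖) z
    rw [← hJz, ← integral_const_mul, ← integral_const_mul]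
    exact integral_mono ((integrable_norm_stft_mul_norm_stft_sub Ψ Φ u z).const_mul _)
      ((hint.comp_sub_right z).const_mul _) fun w =>
      ha.pow_mul_mul_le hb (fun w => norm_nonneg _) hC h z w (norm_nonneg _)
  refine ⟨c * C * J, by positivity, fun z => ?_⟩
  have haz := ha.nonneg z
  calc a z ^ N * ‖stft Φ u z.1 z.2‖
      ≤ a z ^ N * (c * ∫ w : V × V, ‖stft Ψ u w.1 w.2‖ *
          ‖stft Ψ (Φ : 𝓢'(V, ℂ)) (w - z).1 (w - z).2‖) := by
        gcongr
        exact norm_stft_le_integral hΨ Φ u z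
    _ = c * (a z ^ N * ∫ w : V × V, ‖stft Ψ u w.1 w.2‖ *
          ‖stft Ψ (Φ : 𝓢'(V, ℂ)) (w - z).1 (w - z).2‖) := mul_left_comm _ _ _
    _ ≤ c * (C * b z ^ M * J) := by exact mul_le_mul_of_nonneg_left (hconv z) hc
    _ = c * C * J * b z ^ M := by ring

end ChangeOfWindow

section Anisotropic

variable {V : Type*} [NormedAddCommGroup V]

/-- The anisotropic size `max(|x|, |ξ|^{1/s})`, homogeneous for `(x, ξ) ↦ (t x, tˢ ξ)`. -/
def anisoNorm (s : ℝ) (z : V × V) : ℝ := max ‖z.1‖ (‖z.2‖ ^ s⁻¹)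

theorem anisoNorm_nonneg (s : ℝ) (z : V × V) : 0 ≤ anisoNorm s z :=
  le_max_of_le_left (norm_nonneg _)

theorem norm_fst_le_anisoNorm (s : ℝ) (z : V × V) : ‖z.1‖ ≤ anisoNorm s z := le_max_left _ _

theorem norm_snd_le_anisoNorm_rpow {s : ℝ} (hs : 0 < s) (z : V × V) :
    ‖z.2‖ ≤ anisoNorm s z ^ s :=
  (Real.rpow_inv_le_iff_of_pos (norm_nonneg _) (anisoNorm_nonneg s z) hs).mp (le_max_right _ _)

theorem norm_le_max_of_anisoNorm_le {s ε : ℝ} (hs : 0 < s) {z : V × V} (hz : anisoNorm s z ≤ ε) :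
    ‖z‖ ≤ max ε (ε ^ s) :=
  max_le_max ((norm_fst_le_anisoNorm s z).trans hz) ((norm_snd_le_anisoNorm_rpow hs z).trans
    (Real.rpow_le_rpow (anisoNorm_nonneg s z) hz hs.le))

theorem norm_eq_one_of_anisoNorm_eq_one {s : ℝ} (hs : 0 < s) {z : V × V}
    (hz : anisoNorm s z = 1) : ‖z‖ = 1 := by
  refine le_antisymm (by simpa using norm_le_max_of_anisoNorm_le hs hz.le) ?_
  rcases max_choice ‖z.1‖ (‖z.2‖ ^ s⁻¹) with h | h
  · exact (hz.symm.trans h).trans_le (norm_fst_le z)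
  · have hsnd : ‖z.2‖ = 1 := by
      rw [← Real.rpow_inv_rpow (norm_nonneg z.2) hs.ne', ← h, ← anisoNorm, hz, Real.one_rpow]
    exact hsnd.symm.trans_le (norm_snd_le z)

theorem rpow_le_one_add_pow {x r : ℝ} (hx : 0 ≤ x) (hr : 0 ≤ r) : x ^ r ≤ (1 + x) ^ ⌈r⌉₊ := by
  calc x ^ r ≤ (1 + x) ^ r := Real.rpow_le_rpow hx (by linarith) hr
    _ ≤ (1 + x) ^ (⌈r⌉₊ : ℝ) := Real.rpow_le_rpow_of_exponent_le (by linarith) (Nat.le_ceil r)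
    _ = (1 + x) ^ ⌈r⌉₊ := Real.rpow_natCast _ _

theorem weight_le_anisoNorm {s : ℝ} (hs : 0 < s) (z : V × V) :
    weight z ≤ 2 * (1 + anisoNorm s z) ^ (1 + ⌈s⌉₊) := by
  have hnonneg := anisoNorm_nonneg s z
  have hfst := norm_fst_le_anisoNorm s z
  have hsnd := (norm_snd_le_anisoNorm_rpow hs z).trans (rpow_le_one_add_pow hnonneg hs.le)
  have hone : 1 ≤ (1 + anisoNorm s z) ^ ⌈s⌉₊ := one_le_pow₀ (by linarith)
  calc weight z ≤ (1 + anisoNorm s z) * (2 * (1 + anisoNorm s z) ^ ⌈s⌉₊) := by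
        unfold weight
        gcongr
        linarith
    _ = 2 * (1 + anisoNorm s z) ^ (1 + ⌈s⌉₊) := by rw [pow_add, pow_one]; ring

theorem one_add_anisoNorm_le {s : ℝ} (hs : 0 < s) (z : V × V) :
    1 + anisoNorm s z ≤ 2 * weight z ^ (1 + ⌈s⁻¹⌉₊) := by
  have hw := one_le_weight z
  have hfst : ‖z.1‖ ≤ weight z := (le_add_of_nonneg_left zero_le_one).trans
    (le_mul_of_one_le_right (by positivity) (one_le_one_add_norm z.2))
  have hsnd : 1 + ‖z.2‖ ≤ weight z :=
    le_mul_of_one_le_left (by positivity) (one_le_one_add_norm z.1)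
  have hsnd_rpow : ‖z.2‖ ^ s⁻¹ ≤ weight z ^ (1 + ⌈s⁻¹⌉₊) :=
    (rpow_le_one_add_pow (norm_nonneg _) (inv_nonneg.mpr hs.le)).trans <|
      (pow_le_pow_left₀ (by positivity) hsnd _).trans (pow_le_pow_right₀ hw (by omega))
  have hmax : anisoNorm s z ≤ weight z ^ (1 + ⌈s⁻¹⌉₊) :=
    max_le (hfst.trans (le_self_pow₀ hw (by omega))) hsnd_rpow
  linarith [one_le_pow₀ (n := 1 + ⌈s⁻¹⌉₊) hw]

theorem weight_le_of_anisoNorm_le {W : Type*} [NormedAddCommGroup W] {s ε : ℝ} (hs : 0 < s)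
    (hε : 0 < ε) (hε1 : ε ≤ 1) {z : V × V} {w : W × W}
    (h : ε * anisoNorm s z ≤ anisoNorm s w) :
    weight z ≤ 2 * (ε⁻¹ * 2) ^ (1 + ⌈s⌉₊) * weight w ^ ((1 + ⌈s⁻¹⌉₊) * (1 + ⌈s⌉₊)) := by
  have hz := anisoNorm_nonneg s z
  have hle : 1 + anisoNorm s z ≤ ε⁻¹ * (1 + anisoNorm s w) := by
    rw [mul_add, mul_one]
    exact add_le_add ((one_le_inv₀ hε).mpr hε1) ((le_inv_mul_iff₀ hε).mpr h)
  calc weight z ≤ 2 * (1 + anisoNorm s z) ^ (1 + ⌈s⌉₊) := weight_le_anisoNorm hs z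
    _ ≤ 2 * (ε⁻¹ * (2 * weight w ^ (1 + ⌈s⁻¹⌉₊))) ^ (1 + ⌈s⌉₊) := by
        gcongr
        exact hle.trans (mul_le_mul_of_nonneg_left (one_add_anisoNorm_le hs w) (by positivity))
    _ = _ := by rw [← mul_assoc, mul_pow _ (weight w ^ _), ← pow_mul, ← mul_assoc]

theorem exists_weight_pow_mul_le {α : Type*} {s : ℝ} (hs : 0 < s) {F : V × V → α → ℝ}
    {P : V × V → α → Prop} (hF : ∀ z w, 0 ≤ F z w)
    (h : ∀ N : ℕ, ∃ C, ∀ z w, P z w → anisoNorm s z ^ N * F z w ≤ C) (N : ℕ) :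
    ∃ C, 0 ≤ C ∧ ∀ z w, P z w → weight z ^ N * F z w ≤ C := by
  set m := (1 + ⌈s⌉₊) * N
  obtain ⟨A, hA⟩ := h 0
  obtain ⟨B, hB⟩ := h m
  refine ⟨2 ^ N * (2 ^ m * (|A| + |B|)), by positivity, fun z w hP => ?_⟩
  have hz := anisoNorm_nonneg s z
  have hFzw := hF z w
  have hadd : (1 + anisoNorm s z) ^ m ≤ 2 ^ m * (1 + anisoNorm s z ^ m) := by
    refine (add_pow_le zero_le_one hz m).trans ?_
    rw [one_pow]
    gcongr <;> [norm_num; omega]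
  calc weight z ^ N * F z w ≤ (2 * (1 + anisoNorm s z) ^ (1 + ⌈s⌉₊)) ^ N * F z w := by
        have hweight := weight_pos z
        gcongr
        exact weight_le_anisoNorm hs z
    _ = 2 ^ N * ((1 + anisoNorm s z) ^ m * F z w) := by rw [mul_pow, ← pow_mul, mul_assoc]
    _ ≤ 2 ^ N * ((2 ^ m * (1 + anisoNorm s z ^ m)) * F z w) := by gcongr
    _ = 2 ^ N * (2 ^ m * (anisoNorm s z ^ 0 * F z w + anisoNorm s z ^ m * F z w)) := by ring
    _ ≤ 2 ^ N * (2 ^ m * (|A| + |B|)) := by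
        gcongr
        · exact (hA z w hP).trans (le_abs_self _)
        · exact (hB z w hP).trans (le_abs_self _)

section Dilation

variable [NormedSpace ℝ V]

/-- The anisotropic dilation `(x, ξ) ↦ (t x, tˢ ξ)`. -/
def anisoDilation (s t : ℝ) (z : V × V) : V × V := (t • z.1, t ^ s • z.2)

theorem anisoDilation_inv_cancel {s t : ℝ} (ht : 0 < t) (z : V × V) :
    anisoDilation s t (anisoDilation s t⁻¹ z) = z :=
  Prod.ext (smul_inv_smul₀ ht.ne' z.1) <| by
    simp only [anisoDilation, Real.inv_rpow ht.le]
    exact smul_inv_smul₀ (Real.rpow_pos_of_pos ht s).ne' z.2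

theorem anisoNorm_anisoDilation {s t : ℝ} (hs : 0 < s) (ht : 0 ≤ t) (z : V × V) :
    anisoNorm s (anisoDilation s t z) = t * anisoNorm s z := by
  rw [anisoNorm, anisoDilation, norm_smul, norm_smul, Real.norm_of_nonneg ht,
    Real.norm_of_nonneg (Real.rpow_nonneg ht s), Real.mul_rpow (Real.rpow_nonneg ht s)
    (norm_nonneg _), Real.rpow_rpow_inv ht hs.ne', ← mul_max_of_nonneg _ _ ht, anisoNorm]

end Dilation

variable [NormedSpace ℝ V] {W : Type*} [NormedAddCommGroup W] [NormedSpace ℝ W]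
  {s : ℝ} {F : V × V → W × W → ℝ}

/-- Rapid decay of `F` along the anisotropic dilates of the points of `U`, uniformly in `U`: the
condition on conical neighbourhoods which defines the Gabor wave front set. -/
def AnisoDecayOn (s : ℝ) (F : V × V → W × W → ℝ) (U : Set ((V × V) × (W × W))) : Prop :=
  ∀ N : ℕ, ∃ C : ℝ, ∀ p ∈ U, ∀ t : ℝ, 0 < t →
    t ^ N * F (anisoDilation s t p.1) (anisoDilation s t p.2) ≤ C

namespace AnisoDecayOn

theorem empty : AnisoDecayOn s F ∅ := fun _ => ⟨0, fun _ hp => absurd hp (Set.notMem_empty _)⟩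

theorem mono {U U' : Set ((V × V) × (W × W))} (h : AnisoDecayOn s F U) (hU : U' ⊆ U) :
    AnisoDecayOn s F U' := fun N => (h N).imp fun _ hC p hp => hC p (hU hp)

theorem union {U U' : Set ((V × V) × (W × W))} (h : AnisoDecayOn s F U)
    (h' : AnisoDecayOn s F U') : AnisoDecayOn s F (U ∪ U') := fun N => by
  obtain ⟨C, hC⟩ := h N
  obtain ⟨C', hC'⟩ := h' N
  refine ⟨max C C', ?_⟩
  rintro p (hp | hp) t ht
  · exact (hC p hp t ht).trans (le_max_left _ _)
  · exact (hC' p hp t ht).trans (le_max_right _ _)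

theorem exists_isOpen_of_isCompact {S : Set ((V × V) × (W × W))} (hS : IsCompact S)
    (h : ∀ p ∈ S, ∃ U, IsOpen U ∧ p ∈ U ∧ AnisoDecayOn s F U) :
    ∃ U, IsOpen U ∧ S ⊆ U ∧ AnisoDecayOn s F U := by
  refine hS.induction_on (p := fun S' => ∃ U, IsOpen U ∧ S' ⊆ U ∧ AnisoDecayOn s F U)
    ⟨∅, isOpen_empty, subset_rfl, empty⟩ ?_ ?_ ?_
  · rintro S₁ S₂ h ⟨U, hU, hSU, hd⟩
    exact ⟨U, hU, h.trans hSU, hd⟩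
  · rintro S₁ S₂ ⟨U₁, hU₁, hSU₁, hd₁⟩ ⟨U₂, hU₂, hSU₂, hd₂⟩
    exact ⟨U₁ ∪ U₂, hU₁.union hU₂, Set.union_subset_union hSU₁ hSU₂, hd₁.union hd₂⟩
  · intro p hp
    obtain ⟨U, hU, hpU, hd⟩ := h p hp
    exact ⟨U, mem_nhdsWithin_of_mem_nhds (hU.mem_nhds hpU), U, hU, subset_rfl, hd⟩

theorem exists_sphere_prod_ball [FiniteDimensional ℝ V]
    (h : ∀ z : V × V, z ≠ 0 → ∃ U, IsOpen U ∧ (z, 0) ∈ U ∧ AnisoDecayOn s F U) :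
    ∃ δ > 0, AnisoDecayOn s F (Metric.sphere 0 1 ×ˢ Metric.ball 0 δ) := by
  have hcompact : IsCompact (Metric.sphere (0 : V × V) 1 ×ˢ ({0} : Set (W × W))) :=
    (isCompact_sphere _ _).prod isCompact_singleton
  obtain ⟨U, hU, hSU, hdecay⟩ := exists_isOpen_of_isCompact (s := s) (F := F) hcompact <| by
    rintro ⟨z, w⟩ ⟨hz, rfl : w = 0⟩
    exact h z (Metric.ne_of_mem_sphere hz one_ne_zero)
  obtain ⟨δ, hδ, hthick⟩ := hcompact.exists_thickening_subset_open hU hSU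
  refine ⟨δ, hδ, hdecay.mono fun p hp => hthick ?_⟩
  refine Metric.mem_thickening_iff.mpr ⟨(p.1, 0), ⟨hp.1, rfl⟩, ?_⟩
  simpa [Prod.dist_eq, hδ] using hp.2

theorem exists_cone {δ : ℝ} (hs : 0 < s) (hδ : 0 < δ)
    (h : AnisoDecayOn s F (Metric.sphere 0 1 ×ˢ Metric.ball 0 δ)) :
    ∃ ε, 0 < ε ∧ ε ≤ 1 ∧ ∀ N : ℕ, ∃ C, ∀ z w, 0 < anisoNorm s z →
      anisoNorm s w ≤ ε * anisoNorm s z → anisoNorm s z ^ N * F z w ≤ C := by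
  obtain ⟨ε, ⟨hεδ, hε1⟩, hε⟩ : ∃ ε : ℝ, (max ε (ε ^ s) < δ ∧ ε ≤ 1) ∧ 0 < ε := by
    have hlim : Filter.Tendsto (fun ε : ℝ => max ε (ε ^ s)) (nhds 0) (nhds 0) := by
      simpa [Real.zero_rpow hs.ne'] using
        (continuous_id.max (Real.continuous_rpow_const hs.le)).tendsto (0 : ℝ)
    have hsmall := (hlim.eventually_lt_const hδ).and (eventually_le_nhds zero_lt_one)
    exact ((hsmall.filter_mono nhdsWithin_le_nhds).and
      (self_mem_nhdsWithin (s := Set.Ioi (0 : ℝ)))).exists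
  refine ⟨ε, hε, hε1, fun N => (h N).imp fun C hC z w hz hw => ?_⟩
  set t := anisoNorm s z with ht
  have hsphere : anisoDilation s t⁻¹ z ∈ Metric.sphere (0 : V × V) 1 := by
    refine mem_sphere_zero_iff_norm.mpr (norm_eq_one_of_anisoNorm_eq_one hs ?_)
    rw [anisoNorm_anisoDilation hs (inv_nonneg.mpr hz.le), ← ht, inv_mul_cancel₀ hz.ne']
  have hball : anisoDilation s t⁻¹ w ∈ Metric.ball (0 : W × W) δ := by
    refine mem_ball_zero_iff.mpr ((norm_le_max_of_anisoNorm_le hs ?_).trans_lt hεδ)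
    rw [anisoNorm_anisoDilation hs (inv_nonneg.mpr hz.le)]
    exact (inv_mul_le_iff₀ hz).mpr (hw.trans_eq (mul_comm _ _))
  have hbound := hC (anisoDilation s t⁻¹ z, anisoDilation s t⁻¹ w) ⟨hsphere, hball⟩ t hz
  rwa [anisoDilation_inv_cancel hz, anisoDilation_inv_cancel hz] at hbound

end AnisoDecayOn

/-- `F` decays rapidly in its first argument, at the expense of a polynomial loss in the second. -/
def RapidlyDecreasingFst (F : V × V → W × W → ℝ) : Prop :=
  ∀ N : ℕ, ∃ (C : ℝ) (M : ℕ), 0 ≤ C ∧ ∀ z w, weight z ^ N * F z w ≤ C * weight w ^ M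

theorem rapidlyDecreasingFst_of_anisoDecayOn [FiniteDimensional ℝ V] (hs : 0 < s)
    (hF : ∀ z w, 0 ≤ F z w) {C₀ : ℝ} {N₀ : ℕ} (hC₀ : 0 ≤ C₀)
    (hpoly : ∀ z w, F z w ≤ C₀ * (weight z * weight w) ^ N₀)
    (h : ∀ z : V × V, z ≠ 0 → ∃ U, IsOpen U ∧ (z, 0) ∈ U ∧ AnisoDecayOn s F U) :
    RapidlyDecreasingFst F := fun N => by
  obtain ⟨δ, hδ, hsphere⟩ := AnisoDecayOn.exists_sphere_prod_ball h
  obtain ⟨ε, hε, hε1, hcone⟩ := hsphere.exists_cone hs hδ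
  obtain ⟨C₁, hC₁, hdecay⟩ := exists_weight_pow_mul_le hs hF
    (P := fun z w => 0 < anisoNorm s z ∧ anisoNorm s w ≤ ε * anisoNorm s z)
    (fun N => (hcone N).imp fun C hC z w hP => hC z w hP.1 hP.2) N
  set c := 2 * (ε⁻¹ * 2) ^ (1 + ⌈s⌉₊)
  set m := (1 + ⌈s⁻¹⌉₊) * (1 + ⌈s⌉₊)
  set C₂ := C₀ * c ^ (N + N₀)
  have hC₂ : 0 ≤ C₂ := by positivity
  refine ⟨C₁ + C₂, m * (N + N₀) + N₀, by positivity, fun z w => ?_⟩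
  have hz := weight_pos z
  have hw := weight_pos w
  rcases le_or_gt (ε * anisoNorm s z) (anisoNorm s w) with hle | hlt
  · calc weight z ^ N * F z w ≤ weight z ^ N * (C₀ * (weight z * weight w) ^ N₀) := by
          gcongr
          exact hpoly z w
      _ = C₀ * weight z ^ (N + N₀) * weight w ^ N₀ := by rw [mul_pow, pow_add]; ring
      _ ≤ C₀ * (c * weight w ^ m) ^ (N + N₀) * weight w ^ N₀ := by
          gcongr
          exact weight_le_of_anisoNorm_le hs hε hε1 hle
      _ = C₂ * weight w ^ (m * (N + N₀) + N₀) := by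
          rw [mul_pow, ← pow_mul, pow_add (weight w)]
          ring
      _ ≤ _ := by gcongr; exact le_add_of_nonneg_left hC₁
  · have hpos : 0 < anisoNorm s z :=
      pos_of_mul_pos_right ((anisoNorm_nonneg s w).trans_lt hlt) hε.le
    calc weight z ^ N * F z w ≤ C₁ := hdecay z w ⟨hpos, hlt.le⟩
      _ ≤ (C₁ + C₂) * 1 := by rw [mul_one]; exact le_add_of_nonneg_right hC₂
      _ ≤ _ := by gcongr; exact one_le_pow₀ (one_le_weight w)

end Anisotropic

section Synthesis

variable {V : Type*} [NormedAddCommGroup V] [InnerProductSpace ℝ V]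
  [FiniteDimensional ℝ V] [MeasurableSpace V] [BorelSpace V]

theorem exists_integral_norm_sq_eq_one : ∃ φ : 𝓢(V, ℂ), ∫ x, ‖φ x‖ ^ 2 = 1 := by
  let b : ContDiffBump (0 : V) := ⟨1, 2, one_pos, one_lt_two⟩
  have hsupp : HasCompactSupport fun x => ((b x : ℝ) : ℂ) :=
    b.hasCompactSupport.comp_left (g := fun r : ℝ => (r : ℂ)) Complex.ofReal_zero
  let ψ : 𝓢(V, ℂ) := hsupp.toSchwartzMap (Complex.ofRealCLM.contDiff.comp b.contDiff)
  have hψ : ψ ≠ 0 := fun h => by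
    have hψ₀ : ψ 0 = ((b 0 : ℝ) : ℂ) := rfl
    rw [h, b.one_of_mem_closedBall (by simp [b])] at hψ₀
    exact zero_ne_one (hψ₀.trans Complex.ofReal_one)
  have hI := integral_norm_sq_pos hψ
  set I := ∫ x, ‖ψ x‖ ^ 2
  refine ⟨((Real.sqrt I)⁻¹ : ℂ) • ψ, ?_⟩
  simp only [smul_apply, norm_smul, norm_inv, Complex.norm_real, mul_pow, inv_pow,
    Real.norm_of_nonneg (Real.sqrt_nonneg I), Real.sq_sqrt hI.le]
  rw [integral_const_mul, inv_mul_cancel₀ hI.ne']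

theorem integral_norm_sq_eq_one {φ : 𝓢(V, ℂ)} (h : eLpNorm φ 2 volume = 1) :
    ∫ x, ‖φ x‖ ^ 2 = 1 := by
  have hnonneg : 0 ≤ ∫ x, ‖φ x‖ ^ 2 := integral_nonneg fun x => by positivity
  rw [(φ.memLp 2 volume).eLpNorm_eq_integral_rpow_norm two_ne_zero ENNReal.ofNat_ne_top,
    ENNReal.ofReal_eq_one] at h
  simp only [ENNReal.toReal_ofNat, Real.rpow_ofNat] at h
  rwa [Real.rpow_inv_eq hnonneg zero_le_one two_ne_zero, Real.one_rpow] at h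

theorem coe_injective : Function.Injective fun f : 𝓢(V, ℂ) => (f : 𝓢'(V, ℂ)) := fun f g hfg => by
  obtain ⟨γ, hγ⟩ := exists_integral_norm_sq_eq_one (V := V)
  ext y
  have hf := stft_inversion_apply γ f y
  have hg := stft_inversion_apply γ g y
  rw [hγ, Complex.ofReal_one, one_mul] at hf hg
  simp only at hfg
  rw [← hf, hfg, hg]

theorem coe_apply_comm (f g : 𝓢(V, ℂ)) : (f : 𝓢'(V, ℂ)) g = (g : 𝓢'(V, ℂ)) f := by
  rw [SchwartzMap.coe_apply, SchwartzMap.coe_apply]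
  simp only [smul_eq_mul, mul_comm]

theorem conj_stft_conjS (γ h : 𝓢(V, ℂ)) (x ξ : V) :
    (starRingEnd ℂ) (stft γ (conjS h : 𝓢'(V, ℂ)) x ξ)
      = stftConst V * (h : 𝓢'(V, ℂ)) (timeFreqShift x ξ γ) := by
  have hconj := stft_conjS_conjS γ (conjS h) x (-ξ)
  rw [neg_neg, conjS_conjS, stft_eq_apply, neg_neg, conjS_conjS] at hconj
  exact hconj.symm

variable {γ : 𝓢(V, ℂ)} {u : 𝓢'(V, ℂ)}

theorem coe_smul_schwartzIntegral_apply {μ : Measure (V × V)}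
    (hΘ : SchwartzIntegrable μ fun z : V × V => stft γ u z.1 z.2 • timeFreqShift z.1 z.2 γ)
    (h : 𝓢(V, ℂ)) :
    (((stftConst V : ℂ) • schwartzIntegral hΘ : 𝓢(V, ℂ)) : 𝓢'(V, ℂ)) h = ∫ z : V × V,
      stft γ u z.1 z.2 * (starRingEnd ℂ) (stft γ (conjS h : 𝓢'(V, ℂ)) z.1 z.2) ∂μ := by
  have hint := continuousLinearMap_schwartzIntegral (𝕜 := ℂ) (h : 𝓢'(V, ℂ)) hΘ
  rw [coe_apply_comm]
  refine (ContinuousLinearMap.map_smul (h : 𝓢'(V, ℂ)) _ _).trans ?_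
  refine (congrArg _ hint).trans ?_
  rw [smul_eq_mul, ← integral_const_mul]
  congr 1 with z
  rw [conj_stft_conjS, mul_left_comm]
  exact congrArg _ (ContinuousLinearMap.map_smul (h : 𝓢'(V, ℂ)) _ _)

theorem apply_eq_integral_stft (hγ : ∫ x, ‖γ x‖ ^ 2 = 1) (u : 𝓢'(V, ℂ)) (h : 𝓢(V, ℂ)) :
    u h = ∫ z : V × V,
      stft γ u z.1 z.2 * (starRingEnd ℂ) (stft γ (conjS h : 𝓢'(V, ℂ)) z.1 z.2) := by
  have hmoyal := moyal γ (conjS h) u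
  rwa [hγ, Complex.ofReal_one, one_mul, pair, conjS_conjS] at hmoyal

theorem coe_schwartzIntegral_stft (hγ : ∫ x, ‖γ x‖ ^ 2 = 1)
    (hΘ : SchwartzIntegrable volume fun z : V × V =>
      stft γ u z.1 z.2 • timeFreqShift z.1 z.2 γ) :
    (((stftConst V : ℂ) • schwartzIntegral hΘ : 𝓢(V, ℂ)) : 𝓢'(V, ℂ)) = u := by
  ext h
  rw [coe_smul_schwartzIntegral_apply hΘ, apply_eq_integral_stft hγ u h]

theorem exists_tendsto_schwartz (u : 𝓢'(V, ℂ)) : ∃ f : ℕ → 𝓢(V, ℂ),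
    Filter.Tendsto (fun n => (f n : 𝓢'(V, ℂ))) Filter.atTop (nhds u) := by
  obtain ⟨γ, hγ⟩ := exists_integral_norm_sq_eq_one (V := V)
  have hcont : Continuous fun z : V × V => stft γ u z.1 z.2 • timeFreqShift z.1 z.2 γ :=
    (continuous_stft γ u).smul (continuous_timeFreqShift γ)
  have hΘ (n : ℕ) : SchwartzIntegrable (volume.restrict (Metric.closedBall 0 n))
      fun z : V × V => stft γ u z.1 z.2 • timeFreqShift z.1 z.2 γ :=
    ⟨hcont, fun k m => (((schwartz_withSeminorms ℂ V ℂ).continuous_seminorm (k, m)).comp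
      hcont).continuousOn.integrableOn_compact (isCompact_closedBall _ _)⟩
  refine ⟨fun n => (stftConst V : ℂ) • schwartzIntegral (hΘ n), ?_⟩
  rw [PointwiseConvergenceCLM.tendsto_iff_forall_tendsto]
  intro h
  rw [apply_eq_integral_stft hγ]
  refine ((aecover_closedBall (μ := (volume : Measure (V × V))) (x := 0)
    tendsto_natCast_atTop_atTop).integral_tendsto_of_countably_generated
      (integrable_stft_mul_conj_stft γ (conjS h) u)).congr fun n =>
        (coe_smul_schwartzIntegral_apply (hΘ n) h).symm

theorem eq_of_seqContinuous {A B : 𝓢'(V, ℂ) → 𝓢'(V, ℂ)} (hA : SeqContinuous A)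
    (hB : SeqContinuous B) (h : ∀ f : 𝓢(V, ℂ), A (f : 𝓢'(V, ℂ)) = B (f : 𝓢'(V, ℂ))) : A = B := by
  funext u
  obtain ⟨f, hf⟩ := exists_tendsto_schwartz u
  exact tendsto_nhds_unique (hA hf) ((hB hf).congr fun n => (h (f n)).symm)

end Synthesis

section GaborMatrix

variable {V : Type*} [NormedAddCommGroup V] [InnerProductSpace ℝ V]

/-- The Gabor matrix `(L Π(w) γ, Π(z) γ)` of an operator `L : 𝓢 → 𝓢'` with respect to the window
`γ`; its decay off `z = 0` governs whether `L` maps `𝓢` into `𝓢`. -/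
def gaborMatrix (L : 𝓢(V, ℂ) →L[ℂ] 𝓢'(V, ℂ)) (γ : 𝓢(V, ℂ)) (z w : V × V) : ℂ :=
  pair (L (timeFreqShift w.1 w.2 γ)) (timeFreqShift z.1 z.2 γ)

/-- The transpose `(Lᵗ f)(g) = (L g)(f)` of an operator `L : 𝓢 → 𝓢'`. -/
def transpose (L : 𝓢(V, ℂ) →L[ℂ] 𝓢'(V, ℂ)) : 𝓢(V, ℂ) →L[ℂ] 𝓢'(V, ℂ) where
  toFun f := ContinuousLinearMap.toPointwiseConvergenceCLM ℂ (RingHom.id ℂ) 𝓢(V, ℂ) ℂ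
    (PointwiseConvergenceCLM.evalCLM (RingHom.id ℂ) ℂ f ∘L L)
  map_add' f g := by
    ext h
    exact ContinuousLinearMap.map_add (L h) f g
  map_smul' c f := by
    ext h
    exact ContinuousLinearMap.map_smul (L h) c f
  cont := PointwiseConvergenceCLM.continuous_of_continuous_eval fun g =>
    ContinuousLinearMap.continuous (L g)

theorem transpose_apply (L : 𝓢(V, ℂ) →L[ℂ] 𝓢'(V, ℂ)) (f g : 𝓢(V, ℂ)) :
    transpose L f g = L g f := rfl

variable [FiniteDimensional ℝ V] [MeasurableSpace V] [BorelSpace V]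
  {γ : 𝓢(V, ℂ)} {L : 𝓢(V, ℂ) →L[ℂ] 𝓢'(V, ℂ)}

theorem integral_weight_pow_inv_nonneg (D : ℕ) : 0 ≤ ∫ w : V × V, (weight w ^ D)⁻¹ :=
  integral_nonneg fun w => inv_nonneg.mpr (pow_nonneg (weight_pos w).le D)

theorem stft_apply_eq_integral_gaborMatrix (hγ : ∫ x, ‖γ x‖ ^ 2 = 1)
    (L : 𝓢(V, ℂ) →L[ℂ] 𝓢'(V, ℂ)) (g : 𝓢(V, ℂ)) (z : V × V) :
    stft γ (L g) z.1 z.2 = (stftConst V : ℂ) ^ 2 *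
      ∫ w : V × V, stft γ (g : 𝓢'(V, ℂ)) w.1 w.2 * gaborMatrix L γ z w := by
  have h := integral_norm_sq_mul_eq_integral_stft γ g
    (PointwiseConvergenceCLM.evalCLM (RingHom.id ℂ) ℂ (conjS (timeFreqShift z.1 z.2 γ)) ∘L L)
  rw [hγ, Complex.ofReal_one, one_mul] at h
  rw [stft_eq, sq, mul_assoc]
  exact congrArg _ h

theorem exists_seminorm_stft_apply_le (hγ : ∫ x, ‖γ x‖ ^ 2 = 1)
    (hL : RapidlyDecreasingFst fun z w => ‖gaborMatrix L γ z w‖) (N : ℕ) :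
    ∃ q : Seminorm ℂ 𝓢(V, ℂ), Continuous q ∧ ∀ (g : 𝓢(V, ℂ)) (z : V × V),
      weight z ^ N * ‖stft γ (L g) z.1 z.2‖ ≤ q g := by
  obtain ⟨C, M, hC, hCM⟩ := hL N
  obtain ⟨D, hD⟩ := exists_integrable_weight_pow (volume : Measure V) (volume : Measure V)
  obtain ⟨q, hq, hqle⟩ := exists_seminorm_stft_coe_le γ (M + D)
  set J := ∫ w : V × V, (weight w ^ D)⁻¹
  let c : NNReal := ⟨stftConst V ^ 2 * (C * J),
    mul_nonneg (sq_nonneg _) (mul_nonneg hC (integral_weight_pow_inv_nonneg D))⟩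
  refine ⟨c • q, hq.const_smul c, fun g z => ?_⟩
  have hz := weight_pos z
  have hbound (w : V × V) : ‖((weight z ^ N : ℝ) : ℂ) * (stft γ (g : 𝓢'(V, ℂ)) w.1 w.2 *
      gaborMatrix L γ z w)‖ ≤ C * q g * (weight w ^ D)⁻¹ := by
    have hw := weight_pos w
    rw [norm_mul, norm_mul, Complex.norm_real, Real.norm_of_nonneg (by positivity),
      ← div_eq_mul_inv, le_div_iff₀ (by positivity)]
    calc weight z ^ N * (‖stft γ (g : 𝓢'(V, ℂ)) w.1 w.2‖ * ‖gaborMatrix L γ z w‖) * weight w ^ D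
        = (weight z ^ N * ‖gaborMatrix L γ z w‖) *
            (‖stft γ (g : 𝓢'(V, ℂ)) w.1 w.2‖ * weight w ^ D) := by ring
      _ ≤ (C * weight w ^ M) * (‖stft γ (g : 𝓢'(V, ℂ)) w.1 w.2‖ * weight w ^ D) :=
          mul_le_mul_of_nonneg_right (hCM z w) (by positivity)
      _ = C * (weight w ^ (M + D) * ‖stft γ (g : 𝓢'(V, ℂ)) w.1 w.2‖) := by rw [pow_add]; ring
      _ ≤ C * q g := mul_le_mul_of_nonneg_left (hqle g w) hC
  have hint := norm_integral_le_of_norm_le (μ := volume) ((hD D le_rfl).const_mul (C * q g))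
    (.of_forall hbound)
  rw [integral_const_mul, integral_const_mul, norm_mul, Complex.norm_real,
    Real.norm_of_nonneg (by positivity)] at hint
  rw [stft_apply_eq_integral_gaborMatrix hγ, norm_mul, norm_pow, Complex.norm_real,
    Real.norm_of_nonneg stftConst_pos.le, mul_left_comm]
  refine (mul_le_mul_of_nonneg_left hint (sq_nonneg _)).trans_eq ?_
  change _ = stftConst V ^ 2 * (C * J) * q g
  ring

theorem exists_seminorm_schwartzIntegral_le (φ : 𝓢(V, ℂ)) {H : 𝓢(V, ℂ) → V × V → ℂ}
    (hH : ∀ N : ℕ, ∃ q : Seminorm ℂ 𝓢(V, ℂ), Continuous q ∧ ∀ g z, weight z ^ N * ‖H g z‖ ≤ q g)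
    (k n : ℕ) : ∃ q : Seminorm ℂ 𝓢(V, ℂ), Continuous q ∧ ∀ (g : 𝓢(V, ℂ))
      (hΘ : SchwartzIntegrable volume fun z => H g z • timeFreqShift z.1 z.2 φ),
      SchwartzMap.seminorm ℂ k n (schwartzIntegral hΘ) ≤ q g := by
  obtain ⟨p, -, M, hM⟩ := polyBounded_timeFreqShift _
    ((schwartz_withSeminorms ℂ V ℂ).continuous_seminorm (k, n))
  obtain ⟨D, hD⟩ := exists_integrable_weight_pow (volume : Measure V) (volume : Measure V)
  obtain ⟨q, hq, hqle⟩ := hH (M + D)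
  set J := ∫ w : V × V, (weight w ^ D)⁻¹
  let c : NNReal := ⟨p φ * J, mul_nonneg (apply_nonneg p φ) (integral_weight_pow_inv_nonneg D)⟩
  refine ⟨c • q, hq.const_smul c, fun g hΘ => (seminorm_schwartzIntegral_le hΘ k n).trans ?_⟩
  have hbound (z : V × V) : SchwartzMap.seminorm ℝ k n (H g z • timeFreqShift z.1 z.2 φ) ≤
      p φ * q g * (weight z ^ D)⁻¹ := by
    have hz := weight_pos z
    rw [← div_eq_mul_inv, le_div_iff₀ (by positivity)]
    calc SchwartzMap.seminorm ℝ k n (H g z • timeFreqShift z.1 z.2 φ) * weight z ^ D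
        = ‖H g z‖ * SchwartzMap.seminorm ℂ k n (timeFreqShift z.1 z.2 φ) * weight z ^ D :=
          congrArg (· * _) (map_smul_eq_mul (SchwartzMap.seminorm ℂ k n) _ _)
      _ ≤ ‖H g z‖ * (weight z ^ M * p φ) * weight z ^ D := by
          gcongr
          exact hM z φ
      _ = p φ * (weight z ^ (M + D) * ‖H g z‖) := by rw [pow_add]; ring
      _ ≤ p φ * q g := mul_le_mul_of_nonneg_left (hqle g z) (apply_nonneg p φ)
  refine (integral_mono (hΘ.integrable_seminorm k n) ((hD D le_rfl).const_mul _) hbound).trans_eq ?_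
  rw [integral_const_mul]
  change _ = p φ * J * q g
  ring

theorem exists_continuousLinearMap_coe_eq (hγ : ∫ x, ‖γ x‖ ^ 2 = 1)
    (hL : RapidlyDecreasingFst fun z w => ‖gaborMatrix L γ z w‖) :
    ∃ T : 𝓢(V, ℂ) →L[ℂ] 𝓢(V, ℂ), ∀ g, (T g : 𝓢'(V, ℂ)) = L g := by
  have hdecay := exists_seminorm_stft_apply_le hγ hL
  have hΘ (g : 𝓢(V, ℂ)) : SchwartzIntegrable volume fun z : V × V =>
      stft γ (L g) z.1 z.2 • timeFreqShift z.1 z.2 γ :=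
    RapidlyDecreasing.schwartzIntegrable_smul (fun N => by
      obtain ⟨q, -, hq⟩ := hdecay N
      exact ⟨q g, hq g⟩) (continuous_stft γ (L g)) γ
  let T₀ (g : 𝓢(V, ℂ)) : 𝓢(V, ℂ) := (stftConst V : ℂ) • schwartzIntegral (hΘ g)
  have hT₀ (g : 𝓢(V, ℂ)) : (T₀ g : 𝓢'(V, ℂ)) = L g := coe_schwartzIntegral_stft hγ (hΘ g)
  let T₁ : 𝓢(V, ℂ) →ₗ[ℂ] 𝓢(V, ℂ) :=
    { toFun := T₀
      map_add' f g := coe_injective (by simp only [map_add, hT₀])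
      map_smul' c g := coe_injective (by simp only [map_smul, hT₀, RingHom.id_apply]) }
  have hT₁ : Continuous T₁ := by
    refine (schwartz_withSeminorms ℂ V ℂ).continuous_of_continuous_comp T₁ fun i => ?_
    obtain ⟨q, hq, hqle⟩ := exists_seminorm_schwartzIntegral_le γ hdecay i.1 i.2
    refine Seminorm.continuous_of_le (q := ‖(stftConst V : ℂ)‖₊ • q) (hq.const_smul _) fun g => ?_
    refine (map_smul_eq_mul (SchwartzMap.seminorm ℂ i.1 i.2) _ _).trans_le ?_
    exact mul_le_mul_of_nonneg_left (hqle g (hΘ g)) (norm_nonneg _)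
  exact ⟨⟨T₁, hT₁⟩, hT₀⟩

variable {T : 𝓢(V, ℂ) →L[ℂ] 𝓢(V, ℂ)}

theorem precomp_coe_eq (hT : ∀ f, (T f : 𝓢'(V, ℂ)) = transpose L f) (f : 𝓢(V, ℂ)) :
    PointwiseConvergenceCLM.precomp ℂ T (f : 𝓢'(V, ℂ)) = L f := by
  ext g
  change (f : 𝓢'(V, ℂ)) (T g) = L f g
  rw [coe_apply_comm, hT, transpose_apply]

theorem stft_neg_snd_eq_pair (hT : ∀ f, (T f : 𝓢'(V, ℂ)) = transpose L f) (φ ψ : 𝓢(V, ℂ))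
    (z : V × V) : stft φ (T (conjS ψ) : 𝓢'(V, ℂ)) z.1 (-z.2) =
      stftConst V * pair (L (timeFreqShift z.1 z.2 (conjS φ))) ψ := by
  rw [stft_eq_apply, neg_neg, hT, transpose_apply, pair]

theorem pair_precomp_eq_integral (hT : ∀ f, (T f : 𝓢'(V, ℂ)) = transpose L f)
    {φ : 𝓢(V, ℂ)} (hφ : ∫ x, ‖φ x‖ ^ 2 = 1) (u : 𝓢'(V, ℂ)) (ψ : 𝓢(V, ℂ)) :
    pair (PointwiseConvergenceCLM.precomp ℂ T u) ψ = ∫ z : V × V, ∫ w : V × V,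
      stftConst V * stft φ (L (timeFreqShift z.1 z.2 (conjS φ))) w.1 w.2 *
        (starRingEnd ℂ) (stft φ (ψ : 𝓢'(V, ℂ)) w.1 w.2) * stft (conjS φ) u z.1 z.2 := by
  have hinner (z : V × V) : ∫ w : V × V,
      stftConst V * stft φ (L (timeFreqShift z.1 z.2 (conjS φ))) w.1 w.2 *
        (starRingEnd ℂ) (stft φ (ψ : 𝓢'(V, ℂ)) w.1 w.2) * stft (conjS φ) u z.1 z.2 =
      stft φ (T (conjS ψ) : 𝓢'(V, ℂ)) z.1 (-z.2) * stft (conjS φ) u z.1 z.2 := by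
    have hmoyal := moyal φ ψ (L (timeFreqShift z.1 z.2 (conjS φ)))
    rw [hφ, Complex.ofReal_one, one_mul] at hmoyal
    rw [stft_neg_snd_eq_pair hT, hmoyal, integral_mul_const, ← integral_const_mul]
    simp only [mul_assoc]
  have hinv := integral_norm_sq_mul_eq_integral_stft φ (T (conjS ψ)) u
  rw [hφ, Complex.ofReal_one, one_mul, ← integral_neg_snd, ← integral_const_mul] at hinv
  refine hinv.trans (integral_congr_ae (.of_forall fun z => ?_))
  refine Eq.trans ?_ (hinner z).symm
  rw [stft_eq_apply (conjS φ), conjS_conjS]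
  exact mul_left_comm _ _ _

end GaborMatrix

section WaveFrontDecay

variable {X V W : Type*} [NormedAddCommGroup X] [InnerProductSpace ℝ X] [FiniteDimensional ℝ X]
  [MeasurableSpace X] [BorelSpace X] [NormedAddCommGroup V] [NormedSpace ℝ V]
  [FiniteDimensional ℝ V] [NormedAddCommGroup W] [NormedSpace ℝ W]

theorem rapidlyDecreasingFst_stft_comp {s : ℝ} (hs : 0 < s) {Ψ : 𝓢(X, ℂ)} {K : 𝓢'(X, ℂ)}
    {J : V × V → W × W → X × X} (hJ : Continuous fun p : (V × V) × (W × W) => J p.1 p.2)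
    (hdil : ∀ t z w, J (anisoDilation s t z) (anisoDilation s t w) = anisoDilation s t (J z w))
    (hweight : ∀ z w, weight (J z w) ≤ weight z * weight w) (hJ₀ : ∀ z, J z 0 = 0 → z = 0)
    (hWF : ∀ z, J z 0 ∉ gaborWF s Ψ K) :
    RapidlyDecreasingFst fun z w => ‖stft Ψ K (J z w).1 (J z w).2‖ := by
  obtain ⟨C, N, hC, hle⟩ := exists_norm_stft_le Ψ K
  refine rapidlyDecreasingFst_of_anisoDecayOn hs (fun _ _ => norm_nonneg _) (N₀ := N) hC
    (fun z w => (hle (J z w)).trans ?_) fun z hz => ?_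
  · have := weight_pos (J z w)
    gcongr
    exact hweight z w
  · have hregular := hWF z
    simp only [gaborWF, Set.mem_ofPred_eq, not_and, not_not] at hregular
    obtain ⟨U, hU, hzU, hdecay⟩ := hregular (mt (hJ₀ z) hz)
    refine ⟨(fun p => J p.1 p.2) ⁻¹' U, hU.preimage hJ, hzU, fun N => ?_⟩
    refine (hdecay N).imp fun C hC p hp t ht => ?_
    beta_reduce
    rw [hdil]
    exact hC _ hp t ht

end WaveFrontDecay

section ProductPhaseSpace

variable {V W : Type*} [NormedAddCommGroup V] [NormedAddCommGroup W]

/-- The component `(x, ξ)` of a phase space point `(x, y, ξ, η)`. -/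
def fstPhase (Z : WithLp 2 (V × W) × WithLp 2 (V × W)) : V × V := (Z.1.fst, Z.2.fst)

/-- The component `(y, η)` of a phase space point `(x, y, ξ, η)`. -/
def sndPhase (Z : WithLp 2 (V × W) × WithLp 2 (V × W)) : W × W := (Z.1.snd, Z.2.snd)

/-- The phase space point `(x, y, ξ, η)` with components `(x, ξ)` and `(y, η)`. -/
def joinPhase (w : V × V) (z : W × W) : WithLp 2 (V × W) × WithLp 2 (V × W) :=
  (WithLp.toLp 2 (w.1, z.1), WithLp.toLp 2 (w.2, z.2))

theorem continuous_joinPhase : Continuous fun p : (V × V) × (W × W) => joinPhase p.1 p.2 := by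
  unfold joinPhase
  fun_prop

theorem anisoDilation_joinPhase [NormedSpace ℝ V] [NormedSpace ℝ W] (s t : ℝ) (w : V × V)
    (z : W × W) : joinPhase (anisoDilation s t w) (anisoDilation s t z) =
      anisoDilation s t (joinPhase w z) := rfl

theorem moderateWeight_fstPhase :
    ModerateWeight fun Z : WithLp 2 (V × W) × WithLp 2 (V × W) => weight (fstPhase Z) where
  nonneg _ := (weight_pos _).le
  add_le Z Z' := weight_add_le (fstPhase Z) (fstPhase Z')
  neg Z := weight_neg (fstPhase Z)
  le_weight Z := by
    have h₁ := WithLp.norm_fst_le (p := 2) V Z.1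
    have h₂ := WithLp.norm_fst_le (p := 2) V Z.2
    unfold weight fstPhase
    gcongr

theorem moderateWeight_sndPhase :
    ModerateWeight fun Z : WithLp 2 (V × W) × WithLp 2 (V × W) => weight (sndPhase Z) where
  nonneg _ := (weight_pos _).le
  add_le Z Z' := weight_add_le (sndPhase Z) (sndPhase Z')
  neg Z := weight_neg (sndPhase Z)
  le_weight Z := by
    have h₁ := WithLp.norm_snd_le (p := 2) V Z.1
    have h₂ := WithLp.norm_snd_le (p := 2) V Z.2
    unfold weight sndPhase
    gcongr

theorem one_add_norm_le_mul (x : WithLp 2 (V × W)) :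
    1 + ‖x‖ ≤ (1 + ‖x.fst‖) * (1 + ‖x.snd‖) := by
  have h : ‖x‖ ≤ ‖x.fst‖ + ‖x.snd‖ := by
    rw [WithLp.prod_norm_eq_of_L2]
    refine Real.sqrt_le_iff.mpr ⟨by positivity, ?_⟩
    nlinarith [norm_nonneg x.fst, norm_nonneg x.snd]
  nlinarith [mul_nonneg (norm_nonneg x.fst) (norm_nonneg x.snd)]

theorem weight_joinPhase_le (w : V × V) (z : W × W) :
    weight (joinPhase w z) ≤ weight w * weight z :=
  (mul_le_mul (one_add_norm_le_mul _) (one_add_norm_le_mul _) (by positivity)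
    (by positivity)).trans_eq (mul_mul_mul_comm _ _ _ _)

end ProductPhaseSpace

section Tensor

variable {V W : Type*} [NormedAddCommGroup V] [InnerProductSpace ℝ V]
  [NormedAddCommGroup W] [InnerProductSpace ℝ W]

theorem tensor_timeFreqShift (w : V × V) (z : W × W) (a : 𝓢(V, ℂ)) (b : 𝓢(W, ℂ)) :
    tensor (timeFreqShift w.1 w.2 a) (timeFreqShift z.1 z.2 b)
      = timeFreqShift (joinPhase w z).1 (joinPhase w z).2 (tensor a b) := by
  ext y
  rw [tensor_apply, timeFreqShift_apply, timeFreqShift_apply, timeFreqShift_apply, tensor_apply,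
    WithLp.prod_inner_apply]
  change _ = Complex.exp ((inner ℝ y.fst w.2 + inner ℝ y.snd z.2 : ℝ) * Complex.I) *
    (a (y.fst - w.1) * b (y.snd - z.1))
  rw [Complex.ofReal_add, add_mul, Complex.exp_add]
  ring

theorem stftConst_withLp_prod [FiniteDimensional ℝ V] [FiniteDimensional ℝ W] :
    stftConst (WithLp 2 (V × W)) = stftConst V * stftConst W := by
  have h : Module.finrank ℝ (WithLp 2 (V × W)) = Module.finrank ℝ V + Module.finrank ℝ W := by
    rw [(WithLp.linearEquiv 2 ℝ (V × W)).finrank_eq, Module.finrank_prod]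
  rw [stftConst, stftConst, stftConst, h, ← Real.rpow_add (by positivity)]
  congr 1
  push_cast
  ring

end Tensor

section Kernel

variable {d : ℕ} {s : ℝ} {Ψ : 𝓢(R2d d, ℂ)} {K : 𝓢'(R2d d, ℂ)}

theorem rapidlyDecreasingFst_stft_of_gaborWF₁_eq_empty (hs : 0 < s) (hΨ : Ψ ≠ 0)
    (hK : gaborWF₁ s Ψ K = ∅) (Φ : 𝓢(R2d d, ℂ)) :
    RapidlyDecreasingFst fun w z => ‖stft Φ K (joinPhase w z).1 (joinPhase w z).2‖ := fun N => by
  have hWF (w : Rd d × Rd d) : joinPhase w 0 ∉ gaborWF s Ψ K :=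
    fun hw => Set.eq_empty_iff_forall_notMem.mp hK w hw
  have hwindow : RapidlyDecreasingFst fun w z =>
      ‖stft Ψ K (joinPhase w z).1 (joinPhase w z).2‖ :=
    rapidlyDecreasingFst_stft_comp hs continuous_joinPhase (anisoDilation_joinPhase s)
      weight_joinPhase_le (fun w hw => congrArg fstPhase hw) hWF
  obtain ⟨C, M, hC, hdecay⟩ := hwindow N
  obtain ⟨C', hC', hdecay'⟩ := moderateWeight_fstPhase.exists_pow_mul_norm_stft_le
    moderateWeight_sndPhase hΨ Φ K hC fun Z => hdecay (fstPhase Z) (sndPhase Z)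
  exact ⟨C', M, hC', fun w z => hdecay' (joinPhase w z)⟩

theorem rapidlyDecreasingFst_stft_of_gaborWF₂_eq_empty (hs : 0 < s) (hΨ : Ψ ≠ 0)
    (hK : gaborWF₂ s Ψ K = ∅) (Φ : 𝓢(R2d d, ℂ)) :
    RapidlyDecreasingFst fun z w => ‖stft Φ K (joinPhase w z).1 (joinPhase w z).2‖ := fun N => by
  have hWF (z : Rd d × Rd d) : joinPhase 0 z ∉ gaborWF s Ψ K := fun hz => by
    refine Set.eq_empty_iff_forall_notMem.mp hK (z.1, -z.2) ?_
    change (WithLp.toLp 2 (0, z.1), WithLp.toLp 2 (0, - -z.2)) ∈ gaborWF s Ψ K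
    rwa [neg_neg]
  have hwindow : RapidlyDecreasingFst fun z w =>
      ‖stft Ψ K (joinPhase w z).1 (joinPhase w z).2‖ :=
    rapidlyDecreasingFst_stft_comp (J := fun z w => joinPhase w z) hs
      (continuous_joinPhase.comp continuous_swap) (fun t z w => anisoDilation_joinPhase s t w z)
      (fun z w => (weight_joinPhase_le w z).trans_eq (mul_comm _ _))
      (fun z hz => congrArg sndPhase hz) hWF
  obtain ⟨C, M, hC, hdecay⟩ := hwindow N
  obtain ⟨C', hC', hdecay'⟩ := moderateWeight_sndPhase.exists_pow_mul_norm_stft_le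
    moderateWeight_fstPhase hΨ Φ K hC fun Z => hdecay (sndPhase Z) (fstPhase Z)
  exact ⟨C', M, hC', fun z w => hdecay' (joinPhase w z)⟩

theorem pair_kernelOp_timeFreqShift (K : 𝓢'(R2d d, ℂ)) (w z : Rd d × Rd d) (f g : 𝓢(Rd d, ℂ)) :
    stftConst (R2d d) * pair (kernelOp K (timeFreqShift z.1 z.2 f)) (timeFreqShift w.1 w.2 g) =
      stft (tensor g (conjS f)) K (joinPhase w (z.1, -z.2)).1 (joinPhase w (z.1, -z.2)).2 := by
  rw [pair_kernelOp, conjS_timeFreqShift, tensor_timeFreqShift w (z.1, -z.2), stft_eq]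

theorem norm_gaborMatrix_kernelOp (K : 𝓢'(R2d d, ℂ)) (γ : 𝓢(Rd d, ℂ)) (z w : Rd d × Rd d) :
    ‖gaborMatrix (kernelOp K) γ z w‖ = (stftConst (R2d d))⁻¹ * ‖stft (tensor γ (conjS γ)) K
      (joinPhase z (w.1, -w.2)).1 (joinPhase z (w.1, -w.2)).2‖ := by
  rw [← pair_kernelOp_timeFreqShift, norm_mul, Complex.norm_real,
    Real.norm_of_nonneg stftConst_pos.le, inv_mul_cancel_left₀ stftConst_pos.ne', gaborMatrix]

theorem gaborMatrix_transpose (L : 𝓢(Rd d, ℂ) →L[ℂ] 𝓢'(Rd d, ℂ)) (γ : 𝓢(Rd d, ℂ))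
    (z w : Rd d × Rd d) : gaborMatrix (transpose L) γ z w =
      gaborMatrix L (conjS γ) (w.1, -w.2) (z.1, -z.2) := by
  rw [gaborMatrix, gaborMatrix, pair, pair, transpose_apply, conjS_timeFreqShift,
    conjS_timeFreqShift, conjS_conjS, neg_neg]

theorem rapidlyDecreasingFst_gaborMatrix_kernelOp (hs : 0 < s) (hΨ : Ψ ≠ 0)
    (hK : gaborWF₁ s Ψ K = ∅) (γ : 𝓢(Rd d, ℂ)) :
    RapidlyDecreasingFst fun z w => ‖gaborMatrix (kernelOp K) γ z w‖ := fun N => by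
  obtain ⟨C, M, hC, hdecay⟩ :=
    rapidlyDecreasingFst_stft_of_gaborWF₁_eq_empty hs hΨ hK (tensor γ (conjS γ)) N
  have hc := stftConst_pos (V := R2d d)
  refine ⟨(stftConst (R2d d))⁻¹ * C, M, by positivity, fun z w => ?_⟩
  beta_reduce
  rw [norm_gaborMatrix_kernelOp, mul_left_comm, mul_assoc, ← weight_neg_snd w]
  exact mul_le_mul_of_nonneg_left (hdecay z (w.1, -w.2)) (by positivity)

theorem rapidlyDecreasingFst_gaborMatrix_transpose_kernelOp (hs : 0 < s) (hΨ : Ψ ≠ 0)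
    (hK : gaborWF₂ s Ψ K = ∅) (γ : 𝓢(Rd d, ℂ)) :
    RapidlyDecreasingFst fun z w => ‖gaborMatrix (transpose (kernelOp K)) γ z w‖ := fun N => by
  obtain ⟨C, M, hC, hdecay⟩ := rapidlyDecreasingFst_stft_of_gaborWF₂_eq_empty hs hΨ hK
    (tensor (conjS γ) (conjS (conjS γ))) N
  have hc := stftConst_pos (V := R2d d)
  refine ⟨(stftConst (R2d d))⁻¹ * C, M, by positivity, fun z w => ?_⟩
  beta_reduce
  rw [gaborMatrix_transpose, norm_gaborMatrix_kernelOp, mul_left_comm, mul_assoc,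
    ← weight_neg_snd w, neg_neg]
  exact mul_le_mul_of_nonneg_left (hdecay z (w.1, -w.2)) (by positivity)

end Kernel

section PhaseSpaceIntegral

/-- The reordering `(x, y, ξ, η) ↦ ((x, ξ), (y, η))`. -/
def phaseReorder (E : Type*) [MeasurableSpace E] : E × E × E × E ≃ᵐ (E × E) × (E × E) :=
  ((MeasurableEquiv.refl E).prodCongr (MeasurableEquiv.prodAssoc.symm.trans
    ((MeasurableEquiv.prodComm.prodCongr (MeasurableEquiv.refl E)).trans
      MeasurableEquiv.prodAssoc))).trans MeasurableEquiv.prodAssoc.symm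

theorem measurePreserving_phaseReorder {E : Type*} [MeasureSpace E]
    [SigmaFinite (volume : Measure E)] :
    MeasurePreserving (phaseReorder E) volume volume := by
  have hassoc : MeasurePreserving (MeasurableEquiv.prodAssoc (α := E) (β := E) (γ := E))
    volume volume := volume_preserving_prodAssoc
  have hassoc' : MeasurePreserving (MeasurableEquiv.prodAssoc (α := E) (β := E) (γ := E × E))
    volume volume := volume_preserving_prodAssoc
  have hcomm : MeasurePreserving (MeasurableEquiv.prodComm (α := E) (β := E)) volume volume :=
    Measure.measurePreserving_swap
  have hswap : MeasurePreserving ((MeasurableEquiv.prodComm (α := E) (β := E)).prodCongr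
      (MeasurableEquiv.refl E)) volume volume := hcomm.prod (MeasurePreserving.id volume)
  exact ((MeasurePreserving.id volume).prod
    ((hassoc.symm.trans hswap).trans hassoc)).trans hassoc'.symm

variable {d : ℕ}

/-- The phase space integrand as a function of `(x, ξ)` and `(y, η)`. -/
def pairedIntegrand (K : 𝓢'(R2d d, ℂ)) (φ ψ : 𝓢(Rd d, ℂ)) (u : 𝓢'(Rd d, ℂ))
    (p : (Rd d × Rd d) × (Rd d × Rd d)) : ℂ :=
  stft (tensor φ φ) K (joinPhase p.1 (p.2.1, -p.2.2)).1 (joinPhase p.1 (p.2.1, -p.2.2)).2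
    * (starRingEnd ℂ) (stft φ (ψ : 𝓢'(Rd d, ℂ)) p.1.1 p.1.2) * stft (conjS φ) u p.2.1 p.2.2

theorem phaseSpaceIntegrand_eq (K : 𝓢'(R2d d, ℂ)) (φ ψ : 𝓢(Rd d, ℂ)) (u : 𝓢'(Rd d, ℂ)) :
    phaseSpaceIntegrand K φ ψ u = pairedIntegrand K φ ψ u ∘ phaseReorder (Rd d) := rfl

theorem continuous_pairedIntegrand (K : 𝓢'(R2d d, ℂ)) (φ ψ : 𝓢(Rd d, ℂ)) (u : 𝓢'(Rd d, ℂ)) :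
    Continuous (pairedIntegrand K φ ψ u) := by
  have hneg : Continuous fun p : (Rd d × Rd d) × (Rd d × Rd d) => (p.1, (p.2.1, -p.2.2)) := by
    fun_prop
  have h₁ := (continuous_stft (tensor φ φ) K).comp (continuous_joinPhase.comp hneg)
  have h₂ := Complex.continuous_conj.comp ((continuous_stft φ (ψ : 𝓢'(Rd d, ℂ))).comp
    (continuous_fst (X := Rd d × Rd d) (Y := Rd d × Rd d)))
  have h₃ := (continuous_stft (conjS φ) u).comp
    (continuous_snd (X := Rd d × Rd d) (Y := Rd d × Rd d))
  exact (h₁.mul h₂).mul h₃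

theorem integrable_pairedIntegrand {K : 𝓢'(R2d d, ℂ)} {φ : 𝓢(Rd d, ℂ)}
    (hK : RapidlyDecreasingFst fun z w =>
      ‖stft (tensor φ φ) K (joinPhase w z).1 (joinPhase w z).2‖)
    (ψ : 𝓢(Rd d, ℂ)) (u : 𝓢'(Rd d, ℂ)) : Integrable (pairedIntegrand K φ ψ u) := by
  obtain ⟨D, hD⟩ := exists_integrable_weight_pow (volume : Measure (Rd d)) (volume : Measure (Rd d))
  obtain ⟨C₁, N₁, hC₁, hu⟩ := exists_norm_stft_le (conjS φ) u
  obtain ⟨C₂, M, hC₂, hKdecay⟩ := hK (N₁ + D)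
  obtain ⟨C₃, hψ⟩ := rapidlyDecreasing_stft_coe φ ψ (M + D)
  refine (((hD D le_rfl).mul_prod (hD D le_rfl)).const_mul (C₁ * C₂ * C₃)).mono'
    (continuous_pairedIntegrand K φ ψ u).aestronglyMeasurable (.of_forall fun ⟨w, z⟩ => ?_)
  have hw := weight_pos w
  have hz := weight_pos z
  have hKwz := hKdecay (z.1, -z.2) w
  beta_reduce at hKwz
  rw [weight_neg_snd] at hKwz
  rw [pairedIntegrand, norm_mul, norm_mul, RCLike.norm_conj, ← mul_inv, ← div_eq_mul_inv,
    le_div_iff₀ (by positivity)]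
  simp only at hKwz ⊢
  set a := ‖stft (tensor φ φ) K (joinPhase w (z.1, -z.2)).1 (joinPhase w (z.1, -z.2)).2‖
  set b := ‖stft φ (ψ : 𝓢'(Rd d, ℂ)) w.1 w.2‖
  calc a * b * ‖stft (conjS φ) u z.1 z.2‖ * (weight w ^ D * weight z ^ D)
      ≤ a * b * (C₁ * weight z ^ N₁) * (weight w ^ D * weight z ^ D) := by
        gcongr
        exact hu z
    _ = C₁ * ((weight z ^ (N₁ + D) * a) * (b * weight w ^ D)) := by rw [pow_add]; ring
    _ ≤ C₁ * ((C₂ * weight w ^ M) * (b * weight w ^ D)) := by gcongr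
    _ = C₁ * C₂ * (weight w ^ (M + D) * b) := by rw [pow_add]; ring
    _ ≤ C₁ * C₂ * C₃ := mul_le_mul_of_nonneg_left (hψ w) (by positivity)

theorem stft_tensor_joinPhase_eq (K : 𝓢'(R2d d, ℂ)) (φ : 𝓢(Rd d, ℂ)) (w z : Rd d × Rd d) :
    stft (tensor φ φ) K (joinPhase w (z.1, -z.2)).1 (joinPhase w (z.1, -z.2)).2 =
      stftConst (Rd d) * stft φ (kernelOp K (timeFreqShift z.1 z.2 (conjS φ))) w.1 w.2 := by
  have h := pair_kernelOp_timeFreqShift K w z (conjS φ) φ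
  rw [conjS_conjS, stftConst_withLp_prod, Complex.ofReal_mul] at h
  rw [← h, stft_eq, mul_assoc]

variable {K : 𝓢'(R2d d, ℂ)} {T : 𝓢(Rd d, ℂ) →L[ℂ] 𝓢(Rd d, ℂ)} {φ : 𝓢(Rd d, ℂ)}

theorem pair_precomp_eq_integral_pairedIntegrand
    (hT : ∀ f, (T f : 𝓢'(Rd d, ℂ)) = transpose (kernelOp K) f) (hφ : ∫ x, ‖φ x‖ ^ 2 = 1)
    (u : 𝓢'(Rd d, ℂ)) (ψ : 𝓢(Rd d, ℂ)) :
    pair (PointwiseConvergenceCLM.precomp ℂ T u) ψ =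
      ∫ z : Rd d × Rd d, ∫ w : Rd d × Rd d, pairedIntegrand K φ ψ u (w, z) := by
  simp only [pairedIntegrand, stft_tensor_joinPhase_eq]
  exact pair_precomp_eq_integral hT hφ u ψ

theorem pair_precomp_eq_integral_phaseSpaceIntegrand
    (hT : ∀ f, (T f : 𝓢'(Rd d, ℂ)) = transpose (kernelOp K) f)
    (hK : RapidlyDecreasingFst fun z w =>
      ‖stft (tensor φ φ) K (joinPhase w z).1 (joinPhase w z).2‖)
    (hφ : ∫ x, ‖φ x‖ ^ 2 = 1) (u : 𝓢'(Rd d, ℂ)) (ψ : 𝓢(Rd d, ℂ)) :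
    Integrable (phaseSpaceIntegrand K φ ψ u) volume ∧
      pair (PointwiseConvergenceCLM.precomp ℂ T u) ψ = ∫ p, phaseSpaceIntegrand K φ ψ u p := by
  have hint := integrable_pairedIntegrand hK ψ u
  have hmp := measurePreserving_phaseReorder (E := Rd d)
  have hemb := (phaseReorder (Rd d)).measurableEmbedding
  rw [phaseSpaceIntegrand_eq]
  refine ⟨(hmp.integrable_comp_emb hemb).mpr hint, ?_⟩
  calc pair (PointwiseConvergenceCLM.precomp ℂ T u) ψ
      = ∫ z : Rd d × Rd d, ∫ w : Rd d × Rd d, pairedIntegrand K φ ψ u (w, z) :=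
        pair_precomp_eq_integral_pairedIntegrand hT hφ u ψ
    _ = ∫ p, pairedIntegrand K φ ψ u p := (integral_prod_symm _ hint).symm
    _ = ∫ p, (pairedIntegrand K φ ψ u ∘ phaseReorder (Rd d)) p := (hmp.integral_comp hemb _).symm

end PhaseSpaceIntegral

end GaborWF

end

theorem proposition4p2 (d : ℕ) (s : ℝ) (hs : 0 < s)
    (K : 𝓢'(GaborWF.R2d d, ℂ))
    -- an arbitrary nonzero window in the definition of the wave front set of `K`
    (Ψ : 𝓢(GaborWF.R2d d, ℂ)) (hΨ : Ψ ≠ 0)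
    (hK₁ : GaborWF.gaborWF₁ s Ψ K = ∅) (hK₂ : GaborWF.gaborWF₂ s Ψ K = ∅) :
    -- (i) `𝒦 : 𝓢 → 𝓢` is continuous
    (∃ T : 𝓢(GaborWF.Rd d, ℂ) →L[ℂ] 𝓢(GaborWF.Rd d, ℂ),
      ∀ f : 𝓢(GaborWF.Rd d, ℂ),
        (T f : 𝓢'(GaborWF.Rd d, ℂ)) = GaborWF.kernelOp K f) ∧
    -- (ii) `𝒦` extends to a sequentially continuous linear operator `A : 𝓢' → 𝓢'` ...
    ∃ A : 𝓢'(GaborWF.Rd d, ℂ) →ₗ[ℂ] 𝓢'(GaborWF.Rd d, ℂ),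
      (SeqContinuous A ∧ ∀ f : 𝓢(GaborWF.Rd d, ℂ),
        A (f : 𝓢'(GaborWF.Rd d, ℂ)) = GaborWF.kernelOp K f) ∧
      -- ... which is unique,
      (∀ B : 𝓢'(GaborWF.Rd d, ℂ) →ₗ[ℂ] 𝓢'(GaborWF.Rd d, ℂ),
        (SeqContinuous B ∧ ∀ f : 𝓢(GaborWF.Rd d, ℂ),
          B (f : 𝓢'(GaborWF.Rd d, ℂ)) = GaborWF.kernelOp K f) → B = A) ∧
      -- (iii) and given by an absolutely convergent phase space integral
      ∀ φ : 𝓢(GaborWF.Rd d, ℂ), eLpNorm φ 2 volume = 1 →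
        ∀ (u : 𝓢'(GaborWF.Rd d, ℂ)) (ψ : 𝓢(GaborWF.Rd d, ℂ)),
          Integrable (GaborWF.phaseSpaceIntegrand K φ ψ u) volume ∧
          GaborWF.pair (A u) ψ = ∫ p, GaborWF.phaseSpaceIntegrand K φ ψ u p := by
  obtain ⟨γ, hγ⟩ := GaborWF.exists_integral_norm_sq_eq_one (V := GaborWF.Rd d)
  obtain ⟨T, hT⟩ := GaborWF.exists_continuousLinearMap_coe_eq hγ
    (GaborWF.rapidlyDecreasingFst_gaborMatrix_kernelOp hs hΨ hK₁ γ)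
  obtain ⟨S, hS⟩ := GaborWF.exists_continuousLinearMap_coe_eq hγ
    (GaborWF.rapidlyDecreasingFst_gaborMatrix_transpose_kernelOp hs hΨ hK₂ γ)
  let A : 𝓢'(GaborWF.Rd d, ℂ) →L[ℂ] 𝓢'(GaborWF.Rd d, ℂ) := PointwiseConvergenceCLM.precomp ℂ S
  have hA : SeqContinuous A.toLinearMap := A.continuous.seqContinuous
  have hAext (f : 𝓢(GaborWF.Rd d, ℂ)) : A (f : 𝓢'(GaborWF.Rd d, ℂ)) = GaborWF.kernelOp K f :=
    GaborWF.precomp_coe_eq hS f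
  refine ⟨⟨T, hT⟩, A.toLinearMap, ⟨hA, hAext⟩, fun B hB => ?_, fun φ hφ u ψ => ?_⟩
  · exact DFunLike.coe_injective <|
      GaborWF.eq_of_seqContinuous hB.1 hA fun f => (hB.2 f).trans (hAext f).symm
  · exact GaborWF.pair_precomp_eq_integral_phaseSpaceIntegrand hS
      (GaborWF.rapidlyDecreasingFst_stft_of_gaborWF₂_eq_empty hs hΨ hK₂ (GaborWF.tensor φ φ))
      (GaborWF.integral_norm_sq_eq_one hφ) u ψ
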